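/- **Setting.** Let $\mathcal X,\mathcal Y$ be finite sets, $\mathcal Z$ a set and $f:\mathcal X\times\mathcal Y\to\mathcal Z$ a function; logarithms are to base $2$. A $k$-round deterministic protocol consists of $k$ messages sent alternately by Alice (who holds $x\in\mathcal X$) and Bob (who holds $y\in\mathcal Y$). Each message is a bit string, possibly empty, determined by the sender's input and the previous messages, and after each history of messages the set of possible next messages is prefix-free. At the end one player announces an answer in $\mathcal Z$, determined by that player's input and the transcript. Which player sends the first message and which one announces the answer is fixed in advance, arbitrarily but in the same way for all protocols below. In a private coin randomised protocol each player's messages and answer may also depend on a private random coin with finite range, the two coins being independent of each other and of the inputs. The communication cost is the maximum, over all inputs and coin outcomes, of the total number of bits sent. * $R^k_\delta(f)$ is the minimum cost of a $k$-round private coin protocol which, on every input $(x,y)$, answers $f(x,y)$ with probability at least $1-\delta$ over the coins. * For a probability distribution $\mu$ on $\mathcal X\times\mathcal Y$, $C^k_{\mu,\delta}(f)$ is the minimum cost of a $k$-round deterministic protocol that answers correctly with probability at least $1-\delta$ when $(x,y)\sim\mu$. * $C^k_{[\,],\delta}(f)=\sup_\mu C^k_{\mu,\delta}(f)$ over all product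 distributions $\mu=\mu_{\mathcal X}\times\mu_{\mathcal Y}$. (A minimum over an empty set of protocols is $+\infty$.) The function $f^m:\mathcal X^m\times\mathcal Y^m\to\mathcal Z^m$ is $f^m(x,y)=(f(x_1,y_1),\dots,f(x_m,y_m))$. A probability distribution $\kappa$ on a finite set $K$ *partitions* $\mu$ if $\mu=\sum_{d\in K}\kappa_d\,\mu_d$ for some product distributions $\mu_d$ on $\mathcal X\times\mathcal Y$, and $H(\kappa)=-\sum_{d}\kappa_d\log\kappa_d$. **Theorem (direct sum, $k$ rounds).** Let $m,k$ be positive integers and $\epsilon,\delta>0$. Then for every probability distribution $\mu$ on $\mathcal X\times\mathcal Y$ and every $\kappa$ that partitions $\mu$, $$R^k_\delta(f^m)\;\ge\; m\left(\frac{\epsilon^2}{2k}\,C^k_{\mu,\delta+2\epsilon}(f)-2-H(\kappa)\right),$$ that is, $R^k_\delta(f^m)\ge m\cdot\sup_{\mu,\kappa}\left(\frac{\epsilon^2}{2k}\,C^k_{\mu,\delta+2\epsilon}(f)-2-H(\kappa)\right)$. **Corollary.** For the same $m,k,\epsilon,\delta$, $$R^k_\delta(f^m)\;\ge\; m\left(\frac{\epsilon^2}{2k}\,C^k_{[\,],\delta+2\epsilon}(f)-2\right).$$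 -/

import Mathlib

noncomputable section

/-- The two parties of a communication protocol. -/
inductive Player
  | alice
  | bob
  deriving DecidableEq

namespace Player

/-- The other party. -/
def other : Player → Player
  | alice => bob
  | bob => alice

/-- The party that speaks in round `i` (counted from `0`), when the parties alternate and
`first` speaks in round `0`. -/
def speaker (first : Player) : ℕ → Player
  | 0 => first
  | i + 1 => (speaker first i).other

end Player

/-- The possible histories of a conversation: the list of the messages (bit strings) sent so far,
the oldest one first. -/
abbrev History := List (List Bool)

/-- A deterministic two-party protocol with exactly `k` rounds (messages may be empty, so fewer
rounds are allowed too). The parties speak alternately, `first` sends the first message, and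
the party `out` announces the answer at the end. Each message depends on the speaker's input and on
the history, the answer on the input of `out` and on the full transcript. Messages are
self-delimiting: after every history, the set of messages that a party may send is prefix-free. -/
structure DetProtocol (first out : Player) (k : ℕ) (X Y Z : Type*) where
  msgA : History → X → List Bool
  msgB : History → Y → List Bool
  prefixFreeA : ∀ h x x', msgA h x <+: msgA h x' → msgA h x = msgA h x'
  prefixFreeB : ∀ h y y', msgB h y <+: msgB h y' → msgB h y = msgB h y'
  outA : History → X → Z
  outB : History → Y → Z

namespace DetProtocol

variable {first out : Player} {k : ℕ} {X Y Z : Type*}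

/-- The message sent in round `i` on input `(x, y)`, when the history is `h`. -/
def msg (P : DetProtocol first out k X Y Z) (x : X) (y : Y) (i : ℕ) (h : History) : List Bool :=
  match Player.speaker first i with
  | .alice => P.msgA h x
  | .bob => P.msgB h y

/-- The list of the first `i` messages exchanged on input `(x, y)`. -/
def history (P : DetProtocol first out k X Y Z) (x : X) (y : Y) : ℕ → History
  | 0 => []
  | i + 1 => P.history x y i ++ [P.msg x y i (P.history x y i)]

/-- The transcript of all `k` messages on input `(x, y)`. -/
def transcript (P : DetProtocol first out k X Y Z) (x : X) (y : Y) : History :=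
  P.history x y k

/-- The answer on input `(x, y)`. -/
def answer (P : DetProtocol first out k X Y Z) (x : X) (y : Y) : Z :=
  match out with
  | .alice => P.outA (P.transcript x y) x
  | .bob => P.outB (P.transcript x y) y

/-- Communication cost: the maximum over all inputs of the total number of bits exchanged. -/
def cost [Fintype X] [Fintype Y] (P : DetProtocol first out k X Y Z) : ℕ :=
  Finset.univ.sup fun p : X × Y => (P.transcript p.1 p.2).flatten.length

open Classical in
/-- `P` computes `f` with distributional error `δ` under `μ`: the probability of a correct answer
on a `μ`-random input is at least `1 - δ`. -/
def HasDistError [Fintype X] [Fintype Y] (P : DetProtocol first out k X Y Z) (f : X → Y → Z)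
    (μ : X × Y → ℝ) (δ : ℝ) : Prop :=
  1 - δ ≤ ∑ p : X × Y, if P.answer p.1 p.2 = f p.1 p.2 then μ p else 0

end DetProtocol

/-- A `k`-round private coin randomised protocol: Alice and Bob draw independent private coins from
finite sets, with arbitrary distributions `coinA` and `coinB`, and then follow a deterministic
protocol in which each party's own coin is part of that party's input. -/
structure PrivateCoinProtocol (first out : Player) (k : ℕ) (X Y Z : Type*) where
  nA : ℕ
  nB : ℕ
  coinA : Fin nA → ℝ
  coinB : Fin nB → ℝ
  coinA_mem : coinA ∈ stdSimplex ℝ (Fin nA)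
  coinB_mem : coinB ∈ stdSimplex ℝ (Fin nB)
  det : DetProtocol first out k (X × Fin nA) (Y × Fin nB) Z

namespace PrivateCoinProtocol

variable {first out : Player} {k : ℕ} {X Y Z : Type*}

/-- Communication cost: the maximum of the number of bits exchanged, over all inputs and all
outcomes of the coins. -/
def cost [Fintype X] [Fintype Y] (P : PrivateCoinProtocol first out k X Y Z) : ℕ :=
  P.det.cost

open Classical in
/-- `P` is a `δ`-error protocol for `f`: on every input the answer is correct with probability at
least `1 - δ` over the coins. -/
def HasError (P : PrivateCoinProtocol first out k X Y Z) (f : X → Y → Z) (δ : ℝ) : Prop :=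
  ∀ x y, 1 - δ ≤ ∑ a, ∑ b,
    if P.det.answer (x, a) (y, b) = f x y then P.coinA a * P.coinB b else 0

end PrivateCoinProtocol

section Complexity

variable {X Y Z : Type*} [Fintype X] [Fintype Y]

/-- `R^k_δ(f)`, the `k`-round `δ`-error private coin randomised communication complexity
(`⊤` if there is no such protocol). -/
def randComplexity (first out : Player) (k : ℕ) (δ : ℝ) (f : X → Y → Z) : ℕ∞ :=
  ⨅ (P : PrivateCoinProtocol first out k X Y Z) (_ : P.HasError f δ), (P.cost : ℕ∞)

/-- `C^k_{μ,δ}(f)`, the `k`-round `δ`-error distributional communication complexity under `μ`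
(`⊤` if there is no such protocol). -/
def distComplexity (first out : Player) (k : ℕ) (μ : X × Y → ℝ) (δ : ℝ) (f : X → Y → Z) : ℕ∞ :=
  ⨅ (P : DetProtocol first out k X Y Z) (_ : P.HasDistError f μ δ), (P.cost : ℕ∞)

/-- `μ` is a product probability distribution on `X × Y`. -/
def IsProductDist (μ : X × Y → ℝ) : Prop :=
  ∃ μX ∈ stdSimplex ℝ X, ∃ μY ∈ stdSimplex ℝ Y, ∀ x y, μ (x, y) = μX x * μY y

/-- `C^k_{[],δ}(f)`, the supremum of `C^k_{μ,δ}(f)` over all product distributions `μ`. -/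
def productComplexity (first out : Player) (k : ℕ) (δ : ℝ) (f : X → Y → Z) : ℕ∞ :=
  ⨆ (μ : X × Y → ℝ) (_ : IsProductDist μ), distComplexity first out k μ δ f

/-- The probability distribution `κ` on the finite index set `K` partitions `μ`: `μ` is the convex
combination, with the weights `κ`, of product distributions `ν d`. -/
def Partitions {K : Type*} [Fintype K] (κ : K → ℝ) (μ : X × Y → ℝ) : Prop :=
  κ ∈ stdSimplex ℝ K ∧ ∃ ν : K → X × Y → ℝ,
    (∀ d, IsProductDist (ν d)) ∧ ∀ p, μ p = ∑ d, κ d * ν d p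

end Complexity

/-- Shannon entropy in bits (with the convention `0 log 0 = 0`). -/
def shannonEntropy {K : Type*} [Fintype K] (κ : K → ℝ) : ℝ :=
  -∑ d, κ d * Real.logb 2 (κ d)

/-- `f^m`, that is, `m` independent instances of `f`, all of which have to be solved. -/
def copies {X Y Z : Type*} (f : X → Y → Z) (m : ℕ) (x : Fin m → X) (y : Fin m → Y) : Fin m → Z :=
  fun i => f (x i) (y i)

/-- A complexity (a natural number or `⊤`) as an extended real number. -/
def complexityToEReal (c : ℕ∞) : EReal := ((c : ENNReal) : EReal)

end

/-! The argument goes through information and message compression. Take a private coin protocol of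
cost `c` for all `m` instances and draw indices `d 1, …, d m` independently from `κ`. Given `d`, the
coordinates are independent and each pair of inputs has a product law. There are at most `2 ^ c`
transcripts, so the transcript carries at most `c` bits about the input, and by independence of the
coordinates the informations about the single coordinates add up to at most `c`
(`sum_coordInfo_le`). Averaging fixes a coordinate `i` and all indices other than the `i`-th such
that coordinate `i` accounts for at most `c / m` bits (`exists_coordInfo_le`).

A single instance is now planted at coordinate `i` (`embed`). Because the laws are products, each
party can draw its other inputs from private coins. The `i`-th index is not available to the
players, so divergences are measured from the mixture over this index of the transcript laws;
replacing the component of index `e` by the mixture costs at most `log (1 / κ e)`, on average `H(κ)`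
(`sum_infoMass_le`). The result is a private coin protocol for `f` whose transcript has mean
divergence at most `c / m + H(κ)` bits from a prior not depending on the input.

This protocol is compressed one message at a time. If the sender's message has law `p` and both
parties know a prior `q`, then rejection sampling from shared samples of `q` replaces the message by
the index of a sample, at an expected cost of `4 D(p ‖ q) + 14` bits (`exists_message_code`). By the
chain rule (`infoMass_eq_sum_tail`) these costs add up over the rounds to four times the total
divergence plus `14 k`. The induction on the rounds (`compressible`) controls the single quantity
"error plus `lam` times bits", so that averaging can fix the shared coins in every round and leave a
deterministic protocol.

With `lam = 1 / b`, a run of more than `b` bits already pays for an error, so cutting off at `b`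
bits does not break the bound (`distComplexity_le_of_mean_le`). Choosing `b` as `2 k / ε ^ 2` times
`c / m + 2 + H(κ)` keeps the total error below `δ + 2 ε`. -/

noncomputable section

/-! ### Operations on deterministic protocols -/

namespace Player

lemma speaker_other (first : Player) (i : ℕ) :
    speaker first.other i = speaker first (i + 1) := by
  induction i with
  | zero => rfl
  | succ i ih => rw [speaker, ih]; rfl

lemma other_other (p : Player) : p.other.other = p := by cases p <;> rfl

end Player

namespace DetProtocol

variable {first out : Player} {k : ℕ} {X Y Z : Type*}

/-- The number of bits exchanged on input `(x, y)`. -/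
def bits (P : DetProtocol first out k X Y Z) (x : X) (y : Y) : ℕ :=
  (P.transcript x y).flatten.length

/-- The protocol that remains after the first message `m`. -/
def tail (P : DetProtocol first out (k + 1) X Y Z) (m : List Bool) :
    DetProtocol first.other out k X Y Z where
  msgA h x := P.msgA (m :: h) x
  msgB h y := P.msgB (m :: h) y
  prefixFreeA h x x' := P.prefixFreeA (m :: h) x x'
  prefixFreeB h y y' := P.prefixFreeB (m :: h) y y'
  outA h x := P.outA (m :: h) x
  outB h y := P.outB (m :: h) y

lemma tail_msg (P : DetProtocol first out (k + 1) X Y Z) (m : List Bool) (x : X) (y : Y) (i : ℕ)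
    (h : History) : (P.tail m).msg x y i h = P.msg x y (i + 1) (m :: h) := by
  unfold msg
  rw [Player.speaker_other]
  rfl

lemma history_succ_eq_cons (P : DetProtocol first out (k + 1) X Y Z) (x : X) (y : Y) (i : ℕ) :
    P.history x y (i + 1) =
      P.msg x y 0 [] :: (P.tail (P.msg x y 0 [])).history x y i := by
  induction i with
  | zero => rfl
  | succ i ih =>
    rw [history, ih, history, tail_msg]
    rfl

lemma transcript_eq_cons (P : DetProtocol first out (k + 1) X Y Z) (x : X) (y : Y) :
    P.transcript x y = P.msg x y 0 [] :: (P.tail (P.msg x y 0 [])).transcript x y :=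
  P.history_succ_eq_cons x y k

lemma answer_eq_tail (P : DetProtocol first out (k + 1) X Y Z) (x : X) (y : Y) :
    P.answer x y = (P.tail (P.msg x y 0 [])).answer x y := by
  cases out <;> simp only [answer, transcript_eq_cons] <;> rfl

lemma bits_eq_tail (P : DetProtocol first out (k + 1) X Y Z) (x : X) (y : Y) :
    P.bits x y = (P.msg x y 0 []).length + (P.tail (P.msg x y 0 [])).bits x y := by
  simp [bits, transcript_eq_cons]

/-- Exchange the roles of the two parties. -/
def swap (P : DetProtocol first out k X Y Z) : DetProtocol first.other out.other k Y X Z where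
  msgA := P.msgB
  msgB := P.msgA
  prefixFreeA := P.prefixFreeB
  prefixFreeB := P.prefixFreeA
  outA := P.outB
  outB := P.outA

lemma swap_msg (P : DetProtocol first out k X Y Z) (x : X) (y : Y) (i : ℕ) (h : History) :
    P.swap.msg y x i h = P.msg x y i h := by
  unfold msg
  rw [Player.speaker_other, Player.speaker]
  cases Player.speaker first i <;> rfl

lemma swap_history (P : DetProtocol first out k X Y Z) (x : X) (y : Y) (i : ℕ) :
    P.swap.history y x i = P.history x y i := by
  induction i with
  | zero => rfl
  | succ i ih => rw [history, history, ih, swap_msg]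

lemma swap_transcript (P : DetProtocol first out k X Y Z) (x : X) (y : Y) :
    P.swap.transcript y x = P.transcript x y := P.swap_history x y k

lemma swap_answer (P : DetProtocol first out k X Y Z) (x : X) (y : Y) :
    P.swap.answer y x = P.answer x y := by
  have h := P.swap_transcript x y
  cases out
  · exact congrArg (fun t => P.outA t x) h
  · exact congrArg (fun t => P.outB t y) h

lemma swap_bits (P : DetProtocol first out k X Y Z) (x : X) (y : Y) :
    P.swap.bits y x = P.bits x y := by
  rw [bits, bits, swap_transcript]

/-- Reinterpret the inputs and the answer of a protocol. -/
def comap {X' Y' Z' : Type*} (P : DetProtocol first out k X Y Z) (φ : X' → X) (ψ : Y' → Y)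
    (ζ : Z → Z') : DetProtocol first out k X' Y' Z' where
  msgA h x := P.msgA h (φ x)
  msgB h y := P.msgB h (ψ y)
  prefixFreeA h x x' := P.prefixFreeA h (φ x) (φ x')
  prefixFreeB h y y' := P.prefixFreeB h (ψ y) (ψ y')
  outA h x := ζ (P.outA h (φ x))
  outB h y := ζ (P.outB h (ψ y))

section comap

variable {X' Y' Z' : Type*} (P : DetProtocol first out k X Y Z) (φ : X' → X) (ψ : Y' → Y)
    (ζ : Z → Z') (x : X') (y : Y')

lemma comap_history (i : ℕ) :
    (P.comap φ ψ ζ).history x y i = P.history (φ x) (ψ y) i := by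
  induction i with
  | zero => rfl
  | succ i ih =>
    rw [history, history, ih]
    rfl

lemma comap_transcript : (P.comap φ ψ ζ).transcript x y = P.transcript (φ x) (ψ y) :=
  P.comap_history φ ψ ζ x y k

lemma comap_answer : (P.comap φ ψ ζ).answer x y = ζ (P.answer (φ x) (ψ y)) := by
  cases out <;> simp only [answer, comap_transcript] <;> rfl

end comap

/-- The protocol without communication in which the answer depends on the input alone. -/
def silent (first out : Player) (k : ℕ) (a : X → Z) (b : Y → Z) :
    DetProtocol first out k X Y Z where
  msgA _ _ := []
  msgB _ _ := []
  prefixFreeA _ _ _ _ := rfl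
  prefixFreeB _ _ _ _ := rfl
  outA _ := a
  outB _ := b

lemma silent_bits (a : X → Z) (b : Y → Z) (x : X) (y : Y) :
    (silent first out k a b).bits x y = 0 := by
  have : ∀ i, ((silent first out k a b).history x y i).flatten = [] := by
    intro i
    induction i with
    | zero => rfl
    | succ i ih =>
      have hm : ∀ h, (silent first out k a b).msg x y i h = [] := by
        intro h; unfold msg; cases Player.speaker first i <;> rfl
      simp [history, ih, hm]
  simp [bits, transcript, this]

/-- Alice first sends the codeword of `e x`, and then the parties continue with the protocol
attached to that value. -/
def prependAlice {J : Type*} [Nonempty J] (code : J → List Bool)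
    (hcode : ∀ i j, code i <+: code j → i = j) (e : X → J)
    (Q : J → DetProtocol (Player.other .alice) out k X Y Z) :
    DetProtocol .alice out (k + 1) X Y Z where
  msgA h x := match h with
    | [] => code (e x)
    | c :: h => (Q (Function.invFun code c)).msgA h x
  msgB h y := match h with
    | [] => []
    | c :: h => (Q (Function.invFun code c)).msgB h y
  prefixFreeA h x x' := match h with
    | [] => fun hp => by rw [hcode _ _ hp]
    | c :: h => (Q (Function.invFun code c)).prefixFreeA h x x'
  prefixFreeB h y y' := match h with
    | [] => fun _ => rfl
    | c :: h => (Q (Function.invFun code c)).prefixFreeB h y y'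
  outA h x := match h with
    -- A default value: a transcript has `k + 1` messages, hence is never empty.
    | [] => (Q (Function.invFun code [])).outA [] x
    | c :: h => (Q (Function.invFun code c)).outA h x
  outB h y := match h with
    | [] => (Q (Function.invFun code [])).outB [] y
    | c :: h => (Q (Function.invFun code c)).outB h y

section prependAlice

variable {J : Type*} [Nonempty J] (code : J → List Bool)
    (hcode : ∀ i j, code i <+: code j → i = j) (e : X → J)
    (Q : J → DetProtocol (Player.other .alice) out k X Y Z)

lemma prependAlice_tail (j : J) : (prependAlice code hcode e Q).tail (code j) = Q j := by
  have hinj : Function.Injective code := fun i j h => hcode i j (h ▸ List.prefix_rfl)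
  have h1 : (prependAlice code hcode e Q).tail (code j) = Q (Function.invFun code (code j)) := rfl
  rw [h1, Function.leftInverse_invFun hinj j]

lemma prependAlice_msg (x : X) (y : Y) :
    (prependAlice code hcode e Q).msg x y 0 [] = code (e x) := rfl

lemma prependAlice_answer (x : X) (y : Y) :
    (prependAlice code hcode e Q).answer x y = (Q (e x)).answer x y := by
  rw [answer_eq_tail, prependAlice_msg, prependAlice_tail]

lemma prependAlice_bits (x : X) (y : Y) :
    (prependAlice code hcode e Q).bits x y = (code (e x)).length + (Q (e x)).bits x y := by
  rw [bits_eq_tail, prependAlice_msg, prependAlice_tail]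

end prependAlice

/-- Truncation keeps a message set prefix-free: a string of length at most `n` is not changed, and a
longer one is cut to the maximal length `n`, so it is a prefix only of itself. -/
lemma prefix_of_take_prefix_take {u v : List Bool} (huv : u <+: v → u = v) (n : ℕ)
    (h : u.take n <+: v.take n) : u.take n = v.take n := by
  rcases le_or_gt u.length n with hu | hu
  · have h1 : u.take n = u := List.take_of_length_le hu
    rw [h1] at h ⊢
    have := huv (h.trans (List.take_prefix n v))
    rw [← this, h1]
  · refine h.eq_of_length_le ?_
    simp [List.length_take, hu.le]

/-- Messages are cut off as soon as `B` bits have been exchanged. -/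
def truncate (P : DetProtocol first out k X Y Z) (B : ℕ) : DetProtocol first out k X Y Z where
  msgA h x := (P.msgA h x).take (B - h.flatten.length)
  msgB h y := (P.msgB h y).take (B - h.flatten.length)
  prefixFreeA h x x' := prefix_of_take_prefix_take (P.prefixFreeA h x x') _
  prefixFreeB h y y' := prefix_of_take_prefix_take (P.prefixFreeB h y y') _
  outA := P.outA
  outB := P.outB

lemma truncate_msg (P : DetProtocol first out k X Y Z) (B : ℕ) (x : X) (y : Y) (i : ℕ)
    (h : History) :
    (P.truncate B).msg x y i h = (P.msg x y i h).take (B - h.flatten.length) := by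
  unfold msg
  cases Player.speaker first i <;> rfl

lemma truncate_bits_le (P : DetProtocol first out k X Y Z) (B : ℕ) (x : X) (y : Y) :
    (P.truncate B).bits x y ≤ B := by
  have : ∀ i, ((P.truncate B).history x y i).flatten.length ≤ B := by
    intro i
    induction i with
    | zero => simp [history]
    | succ i ih =>
      rw [history, truncate_msg]
      simp only [List.flatten_append, List.flatten_cons, List.flatten_nil, List.append_nil,
        List.length_append, List.length_take]
      omega
  exact this k

lemma history_prefix (P : DetProtocol first out k X Y Z) (x : X) (y : Y) {i j : ℕ} (hij : i ≤ j) :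
    P.history x y i <+: P.history x y j := by
  induction j, hij using Nat.le_induction with
  | base => exact List.prefix_rfl
  | succ j _ ih => exact ih.trans (List.prefix_append _ _)

lemma flatten_prefix {h h' : History} (hp : h <+: h') : h.flatten <+: h'.flatten := by
  obtain ⟨t, rfl⟩ := hp
  simp

lemma truncate_history (P : DetProtocol first out k X Y Z) {B : ℕ} {x : X} {y : Y}
    (hB : P.bits x y ≤ B) {i : ℕ} (hi : i ≤ k) :
    (P.truncate B).history x y i = P.history x y i := by
  induction i with
  | zero => rfl
  | succ i ih =>
    have hlen := (flatten_prefix (P.history_prefix x y hi)).length_le.trans hB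
    rw [history, history, ih (by omega), truncate_msg, List.take_of_length_le]
    rw [history] at hlen
    simp only [List.flatten_append, List.flatten_cons, List.flatten_nil, List.append_nil,
        List.length_append] at hlen
    omega

lemma truncate_answer (P : DetProtocol first out k X Y Z) {B : ℕ} {x : X} {y : Y}
    (hB : P.bits x y ≤ B) : (P.truncate B).answer x y = P.answer x y := by
  have h : (P.truncate B).transcript x y = P.transcript x y := P.truncate_history hB le_rfl
  cases out <;> simp only [answer, h] <;> rfl

lemma length_history (P : DetProtocol first out k X Y Z) (x : X) (y : Y) (i : ℕ) :
    (P.history x y i).length = i := by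
  induction i with
  | zero => rfl
  | succ i ih => simp [history, ih]

lemma length_transcript (P : DetProtocol first out k X Y Z) (x : X) (y : Y) :
    (P.transcript x y).length = k := P.length_history x y k

/-- The concatenated bits determine the division into messages. After equal histories the same party
speaks, its two candidate messages are comparable as prefixes of the rest of `l`, and
prefix-freeness makes them equal. -/
lemma history_eq_of_prefix (P : DetProtocol first out k X Y Z) {x x' : X} {y y' : Y}
    {l : List Bool} (h : (P.transcript x y).flatten <+: l)
    (h' : (P.transcript x' y').flatten <+: l) {i : ℕ} (hi : i ≤ k) :
    P.history x y i = P.history x' y' i := by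
  induction i with
  | zero => rfl
  | succ i ih =>
    have e := ih (by omega)
    have h1 := (flatten_prefix (P.history_prefix x y hi)).trans h
    have h2 := (flatten_prefix (P.history_prefix x' y' hi)).trans h'
    rw [history, e] at h1
    rw [history] at h2
    rw [history, history, e]
    simp only [List.flatten_append, List.flatten_cons, List.flatten_nil, List.append_nil] at h1 h2
    have hm : P.msg x y i (P.history x' y' i) = P.msg x' y' i (P.history x' y' i) := by
      have hc := List.prefix_or_prefix_of_prefix h1 h2
      simp only [List.prefix_append_right_inj] at hc
      unfold msg at hc ⊢
      cases hs : Player.speaker first i <;> simp only [hs] at hc ⊢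
      · rcases hc with hc | hc
        · exact P.prefixFreeA _ _ _ hc
        · exact (P.prefixFreeA _ _ _ hc).symm
      · rcases hc with hc | hc
        · exact P.prefixFreeB _ _ _ hc
        · exact (P.prefixFreeB _ _ _ hc).symm
    rw [hm]

lemma bits_le_cost [Fintype X] [Fintype Y] (P : DetProtocol first out k X Y Z) (x : X) (y : Y) :
    P.bits x y ≤ P.cost :=
  Finset.le_sup (f := fun p : X × Y => (P.transcript p.1 p.2).flatten.length)
    (Finset.mem_univ (x, y))

/-- A protocol of cost `c` has at most `2 ^ c` transcripts. -/
lemma card_transcripts_le [Fintype X] [Fintype Y] (P : DetProtocol first out k X Y Z) :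
    (Finset.univ.image fun p : X × Y => P.transcript p.1 p.2).card ≤ 2 ^ P.cost := by
  -- Padding to exactly `P.cost` bits stays injective on transcripts, since each one remains a
  -- prefix of its padded string.
  let pad : History → List.Vector Bool P.cost := fun t =>
    ⟨(t.flatten ++ List.replicate P.cost false).take P.cost, by simp⟩
  have hcard : Fintype.card (List.Vector Bool P.cost) = 2 ^ P.cost := by simp
  rw [← hcard, ← Finset.card_univ]
  refine Finset.card_le_card_of_injOn pad (fun _ _ => Finset.mem_coe.2 (Finset.mem_univ _)) ?_
  intro t ht t' ht' htt
  simp only [Finset.coe_image, Finset.coe_univ, Set.image_univ, Set.mem_range, Prod.exists]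
    at ht ht'
  obtain ⟨x, y, rfl⟩ := ht
  obtain ⟨x', y', rfl⟩ := ht'
  have key : ∀ x y, (P.transcript x y).flatten <+: (pad (P.transcript x y)).1 := by
    intro x y
    have := P.bits_le_cost x y
    exact List.prefix_take_iff.2 ⟨List.prefix_append _ _, this⟩
  refine P.history_eq_of_prefix (key x y) ?_ le_rfl
  rw [htt]
  exact key x' y'

end DetProtocol

end

noncomputable section

/-! ### Sums over product weights -/

section ProductWeights

variable {ι : Type*} [Fintype ι] [DecidableEq ι]

lemma sum_prod_pi {M : Type*} [Fintype M] (g : ι → M → ℝ) :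
    ∑ ω : ι → M, ∏ i, g i (ω i) = ∏ i, ∑ m, g i m := by
  rw [Finset.prod_univ_sum, Fintype.piFinset_univ]

lemma sum_prod_pi_eq_one {M : Type*} [Fintype M] {g : ι → M → ℝ} (hg : ∀ i, ∑ m, g i m = 1) :
    ∑ ω : ι → M, ∏ i, g i (ω i) = 1 := by
  rw [sum_prod_pi]
  exact Finset.prod_eq_one fun i _ => hg i

/-- Resampling one coordinate of a product distribution replaces the factor of that
coordinate. -/
lemma sum_prod_pi_resample {M : Type*} [Fintype M] (g : ι → M → ℝ) (i : ι)
    (hg : ∑ m, g i m = 1) (c : M → ℝ) (G : (ι → M) → ℝ) :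
    ∑ ω : ι → M, (∏ j, g j (ω j)) * ∑ m, c m * G (Function.update ω i m) =
      ∑ ω : ι → M, (∏ j, Function.update g i c j (ω j)) * G ω := by
  have key : ∀ (ω : ι → M) (m : M),
      (∏ j, Function.update g i c j (Function.update ω i m j)) * g i (ω i) =
      (∏ j, g j (ω j)) * c m := by
    intro ω m
    rw [← Finset.mul_prod_erase Finset.univ (fun j => g j (ω j)) (Finset.mem_univ i),
      ← Finset.mul_prod_erase Finset.univ
        (fun j => Function.update g i c j (Function.update ω i m j)) (Finset.mem_univ i)]
    have : ∏ j ∈ Finset.univ.erase i, Function.update g i c j (Function.update ω i m j) =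
        ∏ j ∈ Finset.univ.erase i, g j (ω j) :=
      Finset.prod_congr rfl fun j hj => by
        rw [Function.update_of_ne (Finset.ne_of_mem_erase hj),
          Function.update_of_ne (Finset.ne_of_mem_erase hj)]
    rw [this, Function.update_self, Function.update_self]
    ring
  -- The involution that exchanges the `i`-th coordinate with the fresh sample.
  let σ : (ι → M) × M ≃ (ι → M) × M :=
    { toFun := fun p => (Function.update p.1 i p.2, p.1 i)
      invFun := fun p => (Function.update p.1 i p.2, p.1 i)
      left_inv := fun p => by simp
      right_inv := fun p => by simp }
  calc _ = ∑ p : (ι → M) × M, (∏ j, g j (p.1 j)) * c p.2 * G (Function.update p.1 i p.2) := by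
        rw [Fintype.sum_prod_type]
        simp only [Finset.mul_sum, mul_assoc]
    _ = ∑ p : (ι → M) × M, (∏ j, Function.update g i c j (p.1 j)) * g i p.2 * G p.1 := by
        refine Fintype.sum_equiv σ _ _ fun p => ?_
        simp only [σ, Equiv.coe_fn_mk, key]
    _ = _ := by
        rw [Fintype.sum_prod_type]
        refine Finset.sum_congr rfl fun ω _ => ?_
        simp only [mul_right_comm _ (g i _)]
        rw [← Finset.mul_sum, hg, mul_one]

lemma sum_prod_pi_update {M : Type*} [Fintype M] (g : ι → M → ℝ) (i : ι)
    (hg : ∑ m, g i m = 1) (G : (ι → M) → ℝ) :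
    ∑ ω : ι → M, (∏ j, g j (ω j)) * ∑ m, g i m * G (Function.update ω i m) =
      ∑ ω : ι → M, (∏ j, g j (ω j)) * G ω := by
  rw [sum_prod_pi_resample g i hg, Function.update_eq_self]

lemma sum_prod_pi_apply {M : Type*} [Fintype M] (g : ι → M → ℝ) (hg : ∀ i, ∑ m, g i m = 1)
    (i : ι) (G : M → ℝ) :
    ∑ ω : ι → M, (∏ j, g j (ω j)) * G (ω i) = ∑ m, g i m * G m := by
  rw [← sum_prod_pi_update g i (hg i) fun ω => G (ω i)]
  simp only [Function.update_self]
  rw [← Finset.sum_mul, sum_prod_pi_eq_one hg, one_mul]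

end ProductWeights

/-! ### Prefix-free codes of indices -/

section IndexCode

/-- A self-delimiting code of the positive integers. -/
def posCode (n : ℕ) : List Bool :=
  if h : n ≤ 1 then [false] else true :: (n % 2 == 1) :: posCode (n / 2)
termination_by n
decreasing_by omega

lemma posCode_prefix {i j : ℕ} (hi : 1 ≤ i) (hj : 1 ≤ j) (h : posCode i <+: posCode j) :
    i = j := by
  induction i using Nat.strong_induction_on generalizing j with
  | _ i ih =>
    rw [posCode, posCode.eq_def j] at h
    split_ifs at h with h1 h2 h2
    · omega
    · simp [List.cons_prefix_cons] at h
    · simp [List.cons_prefix_cons] at h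
    · simp only [List.cons_prefix_cons, true_and] at h
      have e := ih (i / 2) (by omega) (by omega) (by omega) h.2
      have e2 : (i % 2 = 1) = (j % 2 = 1) := by simpa using h.1
      have := propext_iff.1 e2
      omega

lemma length_posCode {n : ℕ} (hn : 1 ≤ n) : (posCode n).length = 2 * Nat.log 2 n + 1 := by
  induction n using Nat.strong_induction_on with
  | _ n ih =>
    rw [posCode]
    split_ifs with h1
    · obtain rfl : n = 1 := by omega
      simp
    · rw [List.length_cons, List.length_cons, ih (n / 2) (by omega) (by omega),
        Nat.log_of_one_lt_of_le one_lt_two (by omega : 2 ≤ n)]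
      ring

/-- A self-delimiting code of indices, with one more codeword for failure. -/
def indexCode {N : ℕ} : Option (Fin N) → List Bool
  | none => [false]
  | some j => true :: posCode (j + 1)

lemma indexCode_prefix {N : ℕ} (i j : Option (Fin N)) (h : indexCode i <+: indexCode j) :
    i = j := by
  cases i <;> cases j <;> simp only [indexCode, List.cons_prefix_cons, false_and,
    true_and, Bool.false_eq_true, Bool.true_eq_false] at h ⊢
  have := posCode_prefix (by omega) (by omega) h
  simp only [Option.some.injEq]
  ext
  omega

lemma length_indexCode_some {N : ℕ} (j : Fin N) :
    ((indexCode (some j)).length : ℝ) ≤ 2 * (Real.log (j + 1) / Real.log 2) + 2 := by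
  rw [indexCode, List.length_cons, length_posCode (by omega)]
  have h : (Nat.log 2 (j + 1) : ℝ) ≤ Real.logb 2 ((j + 1 : ℕ) : ℝ) := by
    have := Real.natLog_le_logb (j + 1) 2
    exact_mod_cast this
  rw [Real.logb] at h
  push_cast at h ⊢
  linarith

end IndexCode

/-! ### Rejection sampling by levels of the likelihood ratio -/

section RejectionSampling

/-- The tangent of the logarithm at `2` has slope `1 / 2 < log 2` and intercept `log 2 - 1 < 0`. The
bound is used as `log₂ u ≤ u`. -/
lemma log_le_mul_log_two (u : ℝ) (hu : 0 < u) : Real.log u ≤ u * Real.log 2 := by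
  have h1 := Real.log_le_sub_one_of_pos (show (0 : ℝ) < u / 2 by positivity)
  rw [Real.log_div hu.ne' (by norm_num)] at h1
  nlinarith [Real.log_two_gt_d9, Real.log_two_lt_d9]

lemma sum_geometric_mul_succ (A : ℝ) (N : ℕ) :
    ∑ j ∈ Finset.range N, (1 - A) ^ j * A * ((j + 1) * A) = 1 - (1 + N * A) * (1 - A) ^ N := by
  induction N with
  | zero => simp
  | succ N ih =>
    rw [Finset.sum_range_succ, ih]
    push_cast
    ring

lemma sum_geometric_mul (A : ℝ) (N : ℕ) :
    ∑ j ∈ Finset.range N, (1 - A) ^ j * A = 1 - (1 - A) ^ N := by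
  induction N with
  | zero => simp
  | succ N ih =>
    rw [Finset.sum_range_succ, ih]
    ring

/-- The expected length of the codeword of a (truncated) geometric random variable. -/
lemma sum_geometric_indexCode_le {A : ℝ} (hA0 : 0 < A) (hA1 : A ≤ 1) (N : ℕ) :
    ∑ j : Fin N, (1 - A) ^ (j : ℕ) * A * ((indexCode (some j)).length : ℝ) + (1 - A) ^ N ≤
      2 * (-Real.log A / Real.log 2) + 4 := by
  have hl2 : 0 < Real.log 2 := Real.log_pos (by norm_num)
  have hlA : Real.log A ≤ 0 := Real.log_nonpos hA0.le hA1
  have hr0 : 0 ≤ 1 - A := by linarith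
  have hL : 0 ≤ -Real.log A / Real.log 2 := div_nonneg (by linarith) hl2.le
  -- Split `log₂ (j + 1)` as `log₂ (1 / A) + log₂ ((j + 1) A)` and bound the last term by `(j + 1)
  -- A`, whose sum against the truncated geometric law is at most `1`.
  have hlen : ∀ j : Fin N, ((indexCode (some j)).length : ℝ) ≤
      2 * (-Real.log A / Real.log 2) + 2 + 2 * (((j : ℕ) + 1) * A) := by
    intro j
    refine (length_indexCode_some j).trans ?_
    have hj : (0 : ℝ) < (j : ℕ) + 1 := by positivity
    have h := log_le_mul_log_two (((j : ℕ) + 1) * A) (by positivity)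
    rw [Real.log_mul hj.ne' hA0.ne'] at h
    have h2 : Real.log ((j : ℕ) + 1) / Real.log 2 ≤
        -Real.log A / Real.log 2 + (((j : ℕ) + 1) * A) := by
      rw [div_add' _ _ _ hl2.ne']
      gcongr
      linarith
    linarith
  have hsum : ∑ j : Fin N, (1 - A) ^ (j : ℕ) * A * ((indexCode (some j)).length : ℝ) ≤
      ∑ j : Fin N, ((2 * (-Real.log A / Real.log 2) + 2) * ((1 - A) ^ (j : ℕ) * A) +
        2 * ((1 - A) ^ (j : ℕ) * A * (((j : ℕ) + 1) * A))) := by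
    refine Finset.sum_le_sum fun j _ => ?_
    have := mul_le_mul_of_nonneg_left (hlen j)
      (show 0 ≤ (1 - A) ^ (j : ℕ) * A by positivity)
    linarith
  rw [Finset.sum_add_distrib, ← Finset.mul_sum, ← Finset.mul_sum,
    Fin.sum_univ_eq_sum_range (fun j : ℕ => (1 - A) ^ j * A),
    Fin.sum_univ_eq_sum_range (fun j : ℕ => (1 - A) ^ j * A * ((j + 1) * A)),
    sum_geometric_mul, sum_geometric_mul_succ] at hsum
  have hp : 0 ≤ (1 - A) ^ N := by positivity
  have hp2 : 0 ≤ (1 + N * A) * (1 - A) ^ N := by positivity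
  nlinarith [mul_nonneg hL hp]

variable {M : Type*}

/-- The samples are independent: those before `j` are rejected, the `j`-th contributes `G`, and the
later ones contribute the factor `1`. -/
lemma sum_prod_geometric [Fintype M] {q : M → ℝ} (hq : ∑ m, q m = 1) (a G : M → ℝ) {N : ℕ}
    (j : Fin N) :
    ∑ ω : Fin N → M, (∏ i, q (ω i)) * ((∏ i ∈ Finset.Iio j, (1 - a (ω i))) * G (ω j)) =
      (1 - ∑ m, q m * a m) ^ (j : ℕ) * ∑ m, q m * G m := by
  classical
  have h1 : ∀ F : Fin N → ℝ, ∀ c : ℝ,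
      ∏ i, (if i < j then F i else if i = j then c else 1) = (∏ i ∈ Finset.Iio j, F i) * c := by
    intro F c
    rw [Finset.prod_ite]
    congr 1
    · congr 1
      ext i; simp
    · rw [Finset.prod_eq_single j]
      · simp
      · intro b _ hb; simp [hb]
      · simp
  have h2 : ∀ ω : Fin N → M, (∏ i, q (ω i)) * ((∏ i ∈ Finset.Iio j, (1 - a (ω i))) * G (ω j)) =
      ∏ i, (q (ω i) * if i < j then 1 - a (ω i) else if i = j then G (ω i) else 1) := by
    intro ω
    rw [Finset.prod_mul_distrib, ← h1]
    congr 1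
    refine Finset.prod_congr rfl fun i _ => ?_
    split_ifs with _ h
    · rfl
    · rw [h]
    · rfl
  simp only [h2]
  rw [sum_prod_pi (fun i m => q m * if i < j then 1 - a m else if i = j then G m else 1)]
  have h3 : ∀ i : Fin N, ∑ m, (q m * if i < j then 1 - a m else if i = j then G m else 1) =
      if i < j then 1 - ∑ m, q m * a m else if i = j then ∑ m, q m * G m else 1 := by
    intro i
    split_ifs
    · simp only [mul_sub, mul_one, Finset.sum_sub_distrib, hq]
    · rfl
    · simpa using hq
  simp only [h3]
  rw [h1]
  simp

lemma sum_prod_reject [Fintype M] {q : M → ℝ} (hq : ∑ m, q m = 1) (a : M → ℝ) (N : ℕ) :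
    ∑ ω : Fin N → M, (∏ i, q (ω i)) * ∏ i, (1 - a (ω i)) = (1 - ∑ m, q m * a m) ^ N := by
  simp only [← Finset.prod_mul_distrib]
  rw [sum_prod_pi (fun _ m => q m * (1 - a m))]
  simp [mul_sub, Finset.sum_sub_distrib, hq]

/-- The level of `m`: the likelihood ratio `p m / q m` rounded up to a power of two. -/
def level (p q : M → ℝ) (m : M) : ℕ := ⌈Real.logb 2 (p m / q m)⌉₊

/-- The probability of accepting the sample `m` when sampling at level `s`. -/
def accept (p q : M → ℝ) (s : ℕ) (m : M) : ℝ :=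
  if level p q m = s then p m / (q m * 2 ^ s) else 0

/-- The probability of level `s` under `p`. -/
def levelMass [Fintype M] (p q : M → ℝ) (s : ℕ) : ℝ := ∑ m, if level p q m = s then p m else 0

/-- The probability that one sample from `q` is accepted at level `s`. -/
def acceptMass [Fintype M] (p q : M → ℝ) (s : ℕ) : ℝ := ∑ m, q m * accept p q s m

/-- Draw `m'` from `p` and then output the index of the first sample that is accepted at the level
of `m'`. -/
def rejectionKernel [Fintype M] (p q : M → ℝ) {N : ℕ} (ω : Fin N → M) : Option (Fin N) → ℝ
  | none => ∑ m', p m' * ∏ i, (1 - accept p q (level p q m') (ω i))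
  | some j => ∑ m', p m' * ((∏ i ∈ Finset.Iio j, (1 - accept p q (level p q m') (ω i))) *
      accept p q (level p q m') (ω j))

section

variable {p q : M → ℝ}

lemma accept_nonneg (hp0 : ∀ m, 0 ≤ p m) (hq0 : ∀ m, 0 ≤ q m) (s : ℕ) (m : M) :
    0 ≤ accept p q s m := by
  unfold accept
  have := hp0 m
  have := hq0 m
  split_ifs <;> positivity

/-- This is why the ratio is rounded up: at its own level `s` a message satisfies `p m / q m ≤ 2 ^
s`. -/
lemma accept_le_one (hp0 : ∀ m, 0 ≤ p m) (habs : ∀ m, 0 < p m → 0 < q m) (s : ℕ) (m : M) :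
    accept p q s m ≤ 1 := by
  unfold accept
  split_ifs with h
  · rcases (hp0 m).eq_or_lt with hp | hp
    · simp [← hp]
    · have hq := habs m hp
      rw [div_le_one (by positivity), mul_comm, ← div_le_iff₀ hq, ← h, level]
      have hr : 0 < p m / q m := by positivity
      rw [← Real.rpow_natCast, ← Real.logb_le_iff_le_rpow one_lt_two hr]
      exact Nat.le_ceil _
  · exact zero_le_one

lemma mul_accept (hp0 : ∀ m, 0 ≤ p m) (habs : ∀ m, 0 < p m → 0 < q m) (s : ℕ) (m : M) :
    q m * accept p q s m = (if level p q m = s then p m else 0) / 2 ^ s := by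
  unfold accept
  split_ifs
  · rcases (hp0 m).eq_or_lt with hp | hp
    · simp [← hp]
    · have hq := habs m hp
      field_simp
  · simp

lemma acceptMass_eq [Fintype M] (hp0 : ∀ m, 0 ≤ p m) (habs : ∀ m, 0 < p m → 0 < q m) (s : ℕ) :
    acceptMass p q s = levelMass p q s / 2 ^ s := by
  rw [acceptMass, levelMass, Finset.sum_div]
  exact Finset.sum_congr rfl fun m _ => mul_accept hp0 habs s m

lemma le_levelMass [Fintype M] (hp0 : ∀ m, 0 ≤ p m) (m : M) :
    p m ≤ levelMass p q (level p q m) := by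
  unfold levelMass
  refine le_trans ?_ (Finset.single_le_sum (f := fun m' =>
    if level p q m' = level p q m then p m' else 0) (fun i _ => ?_) (Finset.mem_univ m))
  · simp
  · split_ifs
    exacts [hp0 i, le_rfl]

lemma acceptMass_pos [Fintype M] (hp0 : ∀ m, 0 ≤ p m) (habs : ∀ m, 0 < p m → 0 < q m) {m : M}
    (hm : 0 < p m) : 0 < acceptMass p q (level p q m) := by
  rw [acceptMass_eq hp0 habs]
  have := hm.trans_le (le_levelMass (q := q) hp0 m)
  positivity

lemma acceptMass_le_one [Fintype M] (hp0 : ∀ m, 0 ≤ p m) (hq0 : ∀ m, 0 ≤ q m)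
    (habs : ∀ m, 0 < p m → 0 < q m) (hq1 : ∑ m, q m = 1) (s : ℕ) : acceptMass p q s ≤ 1 := by
  rw [← hq1]
  exact Finset.sum_le_sum fun m _ =>
    mul_le_of_le_one_right (hq0 m) (accept_le_one hp0 habs s m)

lemma rejectionKernel_nonneg [Fintype M] (hp0 : ∀ m, 0 ≤ p m) (hq0 : ∀ m, 0 ≤ q m)
    (habs : ∀ m, 0 < p m → 0 < q m) {N : ℕ} (ω : Fin N → M) (o : Option (Fin N)) :
    0 ≤ rejectionKernel p q ω o := by
  have h1 : ∀ s m, 0 ≤ 1 - accept p q s m := fun s m =>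
    sub_nonneg.2 (accept_le_one hp0 habs s m)
  cases o with
  | none =>
    exact Finset.sum_nonneg fun m _ => mul_nonneg (hp0 m) (Finset.prod_nonneg fun i _ => h1 _ _)
  | some j =>
    exact Finset.sum_nonneg fun m _ => mul_nonneg (hp0 m)
      (mul_nonneg (Finset.prod_nonneg fun i _ => h1 _ _) (accept_nonneg hp0 hq0 _ _))

/-- For each drawn `m'`, either there is a first accepted sample or all samples are rejected. -/
lemma sum_rejectionKernel [Fintype M] (hp1 : ∑ m, p m = 1) {N : ℕ} (ω : Fin N → M) :
    ∑ o, rejectionKernel p q ω o = 1 := by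
  rw [Fintype.sum_option]
  simp only [rejectionKernel]
  rw [Finset.sum_comm, ← Finset.sum_add_distrib]
  refine (Finset.sum_congr rfl fun m _ => ?_).trans hp1
  rw [← Finset.mul_sum, ← mul_add, Finset.prod_one_sub_ordered]
  have : ∀ i : Fin N, Finset.univ.filter (· < i) = Finset.Iio i := fun i => by ext; simp
  simp only [this]
  simp [mul_comm]

lemma pos_of_rejectionKernel_pos [Fintype M] (hp0 : ∀ m, 0 ≤ p m) {N : ℕ} (ω : Fin N → M)
    (j : Fin N)
    (h : 0 < rejectionKernel p q ω (some j)) : 0 < p (ω j) := by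
  by_contra hp
  have hp : p (ω j) = 0 := le_antisymm (not_lt.1 hp) (hp0 _)
  have : ∀ s, accept p q s (ω j) = 0 := fun s => by simp [accept, hp]
  simp [rejectionKernel, this] at h

/-- Acceptance at level `s` has probability proportional to `p` on that level, so the first accepted
sample follows `p` conditioned on the level. The level itself is drawn from `p`, which gives `p m`
times the probability of success within `N` samples. Only the loss by failure makes this an
inequality. -/
lemma rejectionKernel_output_le [Fintype M] [DecidableEq M] (hp0 : ∀ m, 0 ≤ p m)
    (hq0 : ∀ m, 0 ≤ q m) (habs : ∀ m, 0 < p m → 0 < q m) (hq1 : ∑ m, q m = 1) (N : ℕ) (m : M) :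
    ∑ ω : Fin N → M, (∏ i, q (ω i)) *
      ∑ j, (if ω j = m then rejectionKernel p q ω (some j) else 0) ≤ p m := by
  have h1 : ∀ ω : Fin N → M, (∏ i, q (ω i)) *
      ∑ j, (if ω j = m then rejectionKernel p q ω (some j) else 0) =
      ∑ j, ∑ m', p m' * ((∏ i, q (ω i)) *
        ((∏ i ∈ Finset.Iio j, (1 - accept p q (level p q m') (ω i))) *
        (fun n => if n = m then accept p q (level p q m') n else 0) (ω j))) := by
    intro ω
    rw [Finset.mul_sum]
    refine Finset.sum_congr rfl fun j _ => ?_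
    split_ifs with h
    · rw [rejectionKernel, Finset.mul_sum]
      refine Finset.sum_congr rfl fun m' _ => ?_
      simp only [h, if_true]
      ring
    · simp [h]
  simp only [h1]
  rw [Finset.sum_comm]
  have h2 : ∀ j : Fin N, ∑ ω : Fin N → M, ∑ m', p m' * ((∏ i, q (ω i)) *
        ((∏ i ∈ Finset.Iio j, (1 - accept p q (level p q m') (ω i))) *
        (fun n => if n = m then accept p q (level p q m') n else 0) (ω j))) =
      ∑ m', p m' * ((1 - acceptMass p q (level p q m')) ^ (j : ℕ) *
        (q m * accept p q (level p q m') m)) := by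
    intro j
    rw [Finset.sum_comm]
    refine Finset.sum_congr rfl fun m' _ => ?_
    rw [← Finset.mul_sum, sum_prod_geometric hq1 (accept p q (level p q m'))
      (fun n => if n = m then accept p q (level p q m') n else 0)]
    simp [acceptMass]
  simp only [h2]
  rw [Finset.sum_comm]
  have h3 : ∀ m', ∑ j : Fin N, p m' * ((1 - acceptMass p q (level p q m')) ^ (j : ℕ) *
        (q m * accept p q (level p q m') m)) =
      (if level p q m' = level p q m then p m' else 0) * (p m / 2 ^ level p q m *
        ∑ j : Fin N, (1 - acceptMass p q (level p q m)) ^ (j : ℕ)) := by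
    intro m'
    rw [mul_accept hp0 habs]
    by_cases h : level p q m' = level p q m
    · simp only [h, if_true, Finset.mul_sum]
      refine Finset.sum_congr rfl fun j _ => by ring
    · simp [h, Ne.symm h]
  simp only [h3]
  rw [← Finset.sum_mul]
  change levelMass p q (level p q m) * _ ≤ _
  have h4 := acceptMass_eq hp0 habs (level p q m)
  have h5 := sum_geometric_mul (acceptMass p q (level p q m)) N
  rw [← Fin.sum_univ_eq_sum_range (fun j : ℕ => (1 - acceptMass p q (level p q m)) ^ j *
    acceptMass p q (level p q m)), ← Finset.sum_mul] at h5
  have h6 : 0 ≤ (1 - acceptMass p q (level p q m)) ^ N :=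
    pow_nonneg (sub_nonneg.2 (acceptMass_le_one hp0 hq0 habs hq1 _)) _
  calc _ = p m * ((∑ j : Fin N, (1 - acceptMass p q (level p q m)) ^ (j : ℕ)) *
        acceptMass p q (level p q m)) := by rw [h4]; ring
    _ = p m * (1 - (1 - acceptMass p q (level p q m)) ^ N) := by rw [h5]
    _ ≤ p m := mul_le_of_le_one_right (hp0 m) (by linarith)

lemma sum_rejectionKernel_none [Fintype M] (hq1 : ∑ m, q m = 1) (N : ℕ) :
    ∑ ω : Fin N → M, (∏ i, q (ω i)) * rejectionKernel p q ω none =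
      ∑ m', p m' * (1 - acceptMass p q (level p q m')) ^ N := by
  simp only [rejectionKernel, Finset.mul_sum]
  rw [Finset.sum_comm]
  refine Finset.sum_congr rfl fun m' _ => ?_
  simp only [mul_left_comm _ (p m')]
  rw [← Finset.mul_sum, sum_prod_reject hq1, acceptMass]

/-- Every level that occurs with positive probability has positive acceptance probability, so
failure decays geometrically in `N`. -/
lemma tendsto_rejectionKernel_none [Fintype M] (hp0 : ∀ m, 0 ≤ p m) (hq0 : ∀ m, 0 ≤ q m)
    (habs : ∀ m, 0 < p m → 0 < q m) (hq1 : ∑ m, q m = 1) :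
    Filter.Tendsto (fun N => ∑ m', p m' * (1 - acceptMass p q (level p q m')) ^ N)
      Filter.atTop (nhds 0) := by
  rw [show (0 : ℝ) = ∑ m' : M, (0 : ℝ) by simp]
  refine tendsto_finsetSum _ fun m' _ => ?_
  rcases (hp0 m').eq_or_lt with hp | hp
  · simp [← hp]
  · have h1 := acceptMass_pos hp0 habs hp
    have h2 := acceptMass_le_one hp0 hq0 habs hq1 (level p q m')
    have := tendsto_pow_atTop_nhds_zero_of_lt_one (sub_nonneg.2 h2) (by linarith)
    simpa using this.const_mul (p m')

/-- The entropy of the level is at most its mean plus one. -/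
lemma sum_neg_log_levelMass_le [Fintype M] (hp0 : ∀ m, 0 ≤ p m) (hp1 : ∑ m, p m = 1) :
    ∑ m, p m * (-Real.log (levelMass p q (level p q m))) ≤
      (∑ m, p m * (level p q m + 1)) * Real.log 2 := by
  have hb : ∀ m, p m * (-Real.log (levelMass p q (level p q m))) ≤
      p m * (level p q m + 1) * Real.log 2 +
      (p m / levelMass p q (level p q m) * (1 / 2) ^ (level p q m + 1) - p m) := by
    intro m
    rcases (hp0 m).eq_or_lt with hp | hp
    · simp [← hp]
    · have hl := hp.trans_le (le_levelMass (q := q) hp0 m)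
      -- Gibbs' inequality against the law `2 ^ (-(s + 1))` on the levels.
      have h := Real.log_le_sub_one_of_pos
        (show 0 < (1 / 2 : ℝ) ^ (level p q m + 1) / levelMass p q (level p q m) by positivity)
      rw [Real.log_div (by positivity) hl.ne', Real.log_pow, Real.log_div one_ne_zero two_ne_zero,
        Real.log_one] at h
      push_cast at h
      have := mul_le_mul_of_nonneg_left h hp.le
      have e : p m * ((1 / 2 : ℝ) ^ (level p q m + 1) / levelMass p q (level p q m) - 1) =
        p m / levelMass p q (level p q m) * (1 / 2) ^ (level p q m + 1) - p m := by ring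
      rw [e] at this
      linarith
  refine (Finset.sum_le_sum fun m _ => hb m).trans ?_
  rw [Finset.sum_add_distrib, Finset.sum_sub_distrib, hp1, ← Finset.sum_mul]
  have : ∑ m, p m / levelMass p q (level p q m) * (1 / 2 : ℝ) ^ (level p q m + 1) ≤ 1 := by
    classical
    rw [← Finset.sum_fiberwise_of_maps_to (s := Finset.univ)
      (t := Finset.univ.image (level p q)) (g := level p q)
      (fun m _ => Finset.mem_image_of_mem _ (Finset.mem_univ m))]
    have h1 : ∀ s, ∑ m with level p q m = s,
        p m / levelMass p q (level p q m) * (1 / 2 : ℝ) ^ (level p q m + 1) ≤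
        (1 / 2) ^ (s + 1) := by
      intro s
      have : ∀ m ∈ Finset.univ.filter (fun m => level p q m = s),
          p m / levelMass p q (level p q m) * (1 / 2 : ℝ) ^ (level p q m + 1) =
          p m * ((levelMass p q s)⁻¹ * (1 / 2) ^ (s + 1)) := by
        intro m hm
        rw [(Finset.mem_filter.1 hm).2]
        ring
      rw [Finset.sum_congr rfl this, ← Finset.sum_mul, Finset.sum_filter]
      change levelMass p q s * _ ≤ _
      rw [← mul_assoc]
      exact mul_le_of_le_one_left (by positivity) mul_inv_le_one
    refine (Finset.sum_le_sum fun s _ => h1 s).trans ?_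
    have hs : HasSum (fun s : ℕ => (1 / 2 : ℝ) ^ (s + 1)) 1 := by
      simpa [pow_succ', div_eq_mul_inv] using hasSum_geometric_two' 1
    exact sum_le_hasSum _ (fun i _ => by positivity) hs
  linarith

/-- Where the likelihood ratio is at least `1`, rounding up costs at most `1`. Elsewhere the level
is `0` and exceeds the logarithm by `log₂ (q m / p m) ≤ q m / p m`, whose mean under `p` is at most
`1`. Together these give the constant `2`. -/
lemma sum_mul_level_le [Fintype M] (hp0 : ∀ m, 0 ≤ p m) (hq0 : ∀ m, 0 ≤ q m)
    (habs : ∀ m, 0 < p m → 0 < q m) (hq1 : ∑ m, q m = 1) (hp1 : ∑ m, p m = 1) :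
    ∑ m, p m * level p q m ≤ (∑ m, p m * Real.log (p m / q m)) / Real.log 2 + 2 := by
  have hl2 : 0 < Real.log 2 := Real.log_pos (by norm_num)
  have hb : ∀ m, p m * level p q m ≤ p m * Real.log (p m / q m) / Real.log 2 + p m + q m := by
    intro m
    rcases (hp0 m).eq_or_lt with hp | hp
    · simp [← hp, hq0 m]
    · have hq := habs m hp
      have hr : 0 < p m / q m := by positivity
      suffices h : (level p q m : ℝ) ≤ Real.log (p m / q m) / Real.log 2 + 1 + q m / p m by
        have := mul_le_mul_of_nonneg_left h hp.le
        rw [mul_add, mul_add, mul_div_cancel₀ _ hp.ne', mul_one] at this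
        rw [mul_div_assoc]
        exact this
      have h0 : 0 < q m / p m := by positivity
      rw [level, Real.logb]
      rcases le_total 0 (Real.log (p m / q m) / Real.log 2) with h | h
      · linarith [(Nat.ceil_lt_add_one h).le]
      · rw [Nat.ceil_eq_zero.2 h]
        have h3 := log_le_mul_log_two _ h0
        have h4 : Real.log (q m / p m) = -Real.log (p m / q m) := by
          rw [← Real.log_inv, inv_div]
        rw [h4] at h3
        have : -Real.log (p m / q m) / Real.log 2 ≤ q m / p m := (div_le_iff₀ hl2).2 h3
        rw [neg_div] at this
        push_cast
        linarith
  refine (Finset.sum_le_sum fun m _ => hb m).trans ?_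
  rw [Finset.sum_add_distrib, Finset.sum_add_distrib, hp1, hq1, Finset.sum_div]
  linarith

/-- For `m'` of level `s` the index is geometric with success probability `levelMass / 2 ^ s`, so
its code has mean length at most `2 (s + log₂ (1 / levelMass)) + 4`. The mean of `log₂ (1 /
levelMass)` is at most the mean of `s` plus `1`, and the mean of `s` is at most the divergence in
bits plus `2`. This gives `4 (D + 2) + 2 + 4 = 4 D + 14`. -/
lemma rejectionKernel_length_le [Fintype M] (hp0 : ∀ m, 0 ≤ p m) (hq0 : ∀ m, 0 ≤ q m)
    (habs : ∀ m, 0 < p m → 0 < q m) (hq1 : ∑ m, q m = 1) (hp1 : ∑ m, p m = 1) (N : ℕ) :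
    ∑ ω : Fin N → M, (∏ i, q (ω i)) *
      ∑ o, rejectionKernel p q ω o * ((indexCode o).length : ℝ) ≤
      4 / Real.log 2 * ∑ m, p m * Real.log (p m / q m) + 14 := by
  have hl2 : 0 < Real.log 2 := Real.log_pos (by norm_num)
  have h1 : ∑ ω : Fin N → M, (∏ i, q (ω i)) *
      ∑ o, rejectionKernel p q ω o * ((indexCode o).length : ℝ) =
      ∑ m', p m' * (∑ j : Fin N, (1 - acceptMass p q (level p q m')) ^ (j : ℕ) *
        acceptMass p q (level p q m') * ((indexCode (some j)).length : ℝ) +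
        (1 - acceptMass p q (level p q m')) ^ N) := by
    simp only [Fintype.sum_option, mul_add, Finset.sum_add_distrib]
    rw [add_comm]
    congr 1
    · simp only [rejectionKernel, Finset.mul_sum, Finset.sum_mul]
      rw [Finset.sum_comm]
      simp only [Finset.sum_comm (s := Finset.univ (α := Fin N → M))]
      rw [Finset.sum_comm]
      refine Finset.sum_congr rfl fun m' _ => Finset.sum_congr rfl fun j _ => ?_
      rw [acceptMass, ← sum_prod_geometric hq1, Finset.sum_mul, Finset.mul_sum]
      refine Finset.sum_congr rfl fun ω _ => by ring
    · rw [← sum_rejectionKernel_none hq1]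
      simp [indexCode]
  rw [h1]
  have h2 : ∀ m', p m' * (∑ j : Fin N, (1 - acceptMass p q (level p q m')) ^ (j : ℕ) *
        acceptMass p q (level p q m') * ((indexCode (some j)).length : ℝ) +
        (1 - acceptMass p q (level p q m')) ^ N) ≤
      2 / Real.log 2 * (p m' * (-Real.log (levelMass p q (level p q m')))) +
        2 * (p m' * level p q m') + 4 * p m' := by
    intro m'
    rcases (hp0 m').eq_or_lt with hp | hp
    · simp [← hp]
    · have ha := acceptMass_pos hp0 habs hp
      have h := sum_geometric_indexCode_le ha (acceptMass_le_one hp0 hq0 habs hq1 _) N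
      have hl := hp.trans_le (le_levelMass (q := q) hp0 m')
      refine (mul_le_mul_of_nonneg_left h hp.le).trans (le_of_eq ?_)
      rw [acceptMass_eq hp0 habs, Real.log_div hl.ne' (by positivity), Real.log_pow]
      field_simp
      ring
  refine (Finset.sum_le_sum fun m _ => h2 m).trans ?_
  rw [Finset.sum_add_distrib, Finset.sum_add_distrib, ← Finset.mul_sum, ← Finset.mul_sum,
    ← Finset.mul_sum, hp1]
  have h3 := sum_neg_log_levelMass_le (q := q) hp0 hp1
  have h4 := sum_mul_level_le hp0 hq0 habs hq1 hp1
  have h5 : 2 / Real.log 2 * ∑ m, p m * (-Real.log (levelMass p q (level p q m))) ≤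
      2 * (∑ m, p m * level p q m + 1) := by
    rw [div_mul_eq_mul_div, div_le_iff₀ hl2]
    simp only [mul_add, mul_one, Finset.sum_add_distrib, hp1] at h3
    linarith
  have h6 : 4 / Real.log 2 * ∑ m, p m * Real.log (p m / q m) =
      4 * ((∑ m, p m * Real.log (p m / q m)) / Real.log 2) := by ring
  rw [h6]
  linarith

end

end RejectionSampling

end

noncomputable section

/-! ### Compression of one message with shared coins -/

section MessageCode

variable {M X : Type*} [Fintype M] [Fintype X] [DecidableEq X]

open scoped Classical in
/-- The sampling rule of a sender with input `x`; it reports a failure unless `G x` holds. -/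
def senderKernel (G : X → Prop) (p : X → M → ℝ) (q : M → ℝ) {N : ℕ} (ω : Fin N → M) (x : X)
    (o : Option (Fin N)) : ℝ :=
  if G x then rejectionKernel (p x) q ω o else if o = none then 1 else 0

/-- The distribution of the public samples `r.1` and of the answers `r.2` that the sender derives
from them, for all inputs at once. -/
def codeWeight (G : X → Prop) (p : X → M → ℝ) (q : M → ℝ) {N : ℕ}
    (r : (Fin N → M) × (X → Option (Fin N))) : ℝ :=
  (∏ i, q (r.1 i)) * ∏ x, senderKernel G p q r.1 x (r.2 x)

variable {G : X → Prop} {p : X → M → ℝ} {q : M → ℝ}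

omit [Fintype X] [DecidableEq X] in
lemma sum_senderKernel (hp1 : ∀ x, G x → ∑ m, p x m = 1) {N : ℕ} (ω : Fin N → M) (x : X) :
    ∑ o, senderKernel G p q ω x o = 1 := by
  unfold senderKernel
  split_ifs with h
  · exact sum_rejectionKernel (hp1 x h) ω
  · simp

/-- The shared coins contain a table of independent answers, one for every input, so that fixing
them makes the sender deterministic. In a mean that concerns the entry of `x` only, the other
entries sum to `1`. -/
lemma sum_codeWeight_mul (hp1 : ∀ x, G x → ∑ m, p x m = 1) {N : ℕ} (x : X) (hx : G x)
    (H : (Fin N → M) → Option (Fin N) → ℝ) :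
    ∑ r, codeWeight G p q r * H r.1 (r.2 x) =
      ∑ ω : Fin N → M, (∏ i, q (ω i)) * ∑ o, rejectionKernel (p x) q ω o * H ω o := by
  rw [Fintype.sum_prod_type]
  refine Finset.sum_congr rfl fun ω _ => ?_
  simp only [codeWeight, mul_assoc]
  rw [← Finset.mul_sum, sum_prod_pi_apply (fun x o => senderKernel G p q ω x o)
    (fun x => sum_senderKernel hp1 ω x) x (H ω)]
  simp only [senderKernel, hx, if_true]

/-- **Compression of one message.** The sender with input `x` wants to send a message with
distribution `p x`, and the receiver knows the prior `q`. With the help of public coins `r` it is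
enough to send an index whose expected code length is bounded by the divergence of `p x` from
`q`. -/
theorem exists_message_code [DecidableEq M] (G : X → Prop) (p : X → M → ℝ) {q : M → ℝ}
    (hq0 : ∀ m, 0 ≤ q m)
    (hq1 : ∑ m, q m = 1) (hp0 : ∀ x, G x → ∀ m, 0 ≤ p x m) (hp1 : ∀ x, G x → ∑ m, p x m = 1)
    (habs : ∀ x, G x → ∀ m, 0 < p x m → 0 < q m) {η : ℝ} (hη : 0 < η) :
    ∃ (N : ℕ) (w : (Fin N → M) × (X → Option (Fin N)) → ℝ), (∀ r, 0 ≤ w r) ∧ ∑ r, w r = 1 ∧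
      (∀ r, 0 < w r → ∀ x j, r.2 x = some j → 0 < p x (r.1 j)) ∧
      ∀ x, G x →
        (∀ m, ∑ r, w r * (if (r.2 x).map r.1 = some m then 1 else 0) ≤ p x m) ∧
        ∑ r, w r * (if r.2 x = none then 1 else 0) ≤ η ∧
        ∑ r, w r * ((indexCode (r.2 x)).length : ℝ) ≤
          4 / Real.log 2 * ∑ m, p x m * Real.log (p x m / q m) + 14 := by
  have hev : ∀ x, ∀ᶠ N in Filter.atTop, G x →
      ∑ m', p x m' * (1 - acceptMass (p x) q (level (p x) q m')) ^ N ≤ η := by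
    intro x
    by_cases hx : G x
    · filter_upwards [(tendsto_rejectionKernel_none (hp0 x hx) hq0 (habs x hx) hq1).eventually
        (gt_mem_nhds hη)] with N hN _ using hN.le
    · exact Filter.Eventually.of_forall fun N h => absurd h hx
  -- There are finitely many inputs, hence one number of samples serves them all.
  obtain ⟨N, hN⟩ := (Filter.eventually_all.2 hev).exists
  have hk0 : ∀ (ω : Fin N → M) x o, 0 ≤ senderKernel G p q ω x o := by
    intro ω x o
    unfold senderKernel
    split_ifs with h
    · exact rejectionKernel_nonneg (hp0 x h) hq0 (habs x h) ω o
    · exact zero_le_one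
    · exact le_rfl
  refine ⟨N, codeWeight G p q, fun r => mul_nonneg (Finset.prod_nonneg fun i _ => hq0 _)
    (Finset.prod_nonneg fun x _ => hk0 _ _ _), ?_, ?_, ?_⟩
  · rw [Fintype.sum_prod_type]
    simp only [codeWeight, ← Finset.mul_sum]
    have : ∀ ω : Fin N → M, ∑ φ : X → Option (Fin N), ∏ x, senderKernel G p q ω x (φ x) = 1 :=
      fun ω => sum_prod_pi_eq_one fun x => sum_senderKernel hp1 ω x
    simp only [this, mul_one]
    exact sum_prod_pi_eq_one fun _ => hq1
  · intro r hr x j hj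
    have h1 : senderKernel G p q r.1 x (r.2 x) ≠ 0 := fun h0 => by
      rw [codeWeight, Finset.prod_eq_zero (Finset.mem_univ x) h0, mul_zero] at hr
      exact lt_irrefl _ hr
    have h2 := lt_of_le_of_ne (hk0 r.1 x (r.2 x)) h1.symm
    rw [hj, senderKernel] at h2
    by_cases h3 : G x
    · rw [if_pos h3] at h2
      exact pos_of_rejectionKernel_pos (hp0 x h3) _ _ h2
    · simp [h3] at h2
  · intro x hx
    refine ⟨fun m => ?_, ?_, ?_⟩
    · rw [sum_codeWeight_mul hp1 x hx fun ω o => if o.map ω = some m then 1 else 0]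
      refine le_of_eq_of_le ?_ (rejectionKernel_output_le (hp0 x hx) hq0 (habs x hx) hq1 N m)
      simp [Fintype.sum_option]
    · rw [sum_codeWeight_mul hp1 x hx fun ω o => if o = none then 1 else 0]
      refine le_of_eq_of_le ?_ (hN x hx)
      rw [← sum_rejectionKernel_none hq1]
      simp
    · rw [sum_codeWeight_mul hp1 x hx fun ω o => ((indexCode o).length : ℝ)]
      exact rejectionKernel_length_le (hp0 x hx) hq0 (habs x hx) hq1 (hp1 x hx) N

end MessageCode

end

/-! ### Semimeasures on histories -/

noncomputable section

/-- A nonnegative weight on histories, such that the extensions of a history by one message weigh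
together at most as much as the history itself. -/
structure IsSemimeasure (q : History → ℝ) : Prop where
  nonneg : ∀ h, 0 ≤ q h
  sum_le : ∀ h (S : Finset (List Bool)), ∑ m ∈ S, q (h ++ [m]) ≤ q h

namespace IsSemimeasure

variable {q : History → ℝ}

lemma cons (hq : IsSemimeasure q) (m : List Bool) : IsSemimeasure fun h => q (m :: h) where
  nonneg _ := hq.nonneg _
  sum_le h S := hq.sum_le (m :: h) S

lemma append_le (hq : IsSemimeasure q) (h t : History) : q (h ++ t) ≤ q h := by
  induction t generalizing h with
  | nil => simp
  | cons m t ih =>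
    have h1 := ih (h ++ [m])
    have h2 := hq.sum_le h {m}
    rw [Finset.sum_singleton] at h2
    simp only [List.append_assoc, List.singleton_append] at h1
    exact h1.trans h2

/-- Distinct histories of equal length weigh together at most as much as the empty history. -/
lemma sum_le_nil (hq : IsSemimeasure q) {n : ℕ} {S : Finset History}
    (hS : ∀ t ∈ S, t.length = n) : ∑ t ∈ S, q t ≤ q [] := by
  induction n generalizing q S with
  | zero =>
    have : S ⊆ {[]} := fun t ht => by simpa using hS t ht
    exact (Finset.sum_le_sum_of_subset_of_nonneg this fun t _ _ => hq.nonneg t).trans (by simp)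
  | succ n ih =>
    rw [← Finset.sum_fiberwise_of_maps_to (s := S) (t := S.image fun t => t.headD [])
      (g := fun t => t.headD []) (fun t ht => Finset.mem_image_of_mem _ ht)]
    refine le_trans (Finset.sum_le_sum fun m _ => ?_) (hq.sum_le [] (S.image fun t => t.headD []))
    have h1 : ∀ t ∈ S.filter (fun t => t.headD [] = m), t = m :: t.tail := by
      intro t ht
      obtain ⟨htS, rfl⟩ := Finset.mem_filter.1 ht
      cases t with
      | nil => simpa using hS _ htS
      | cons a t => rfl
    have h2 : ∑ t ∈ S with t.headD [] = m, q t =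
        ∑ t ∈ (S.filter (fun t => t.headD [] = m)).image List.tail, q (m :: t) := by
      rw [Finset.sum_image]
      · exact Finset.sum_congr rfl fun t ht => congrArg q (h1 t ht)
      · intro t ht t' ht' htt
        rw [h1 t ht, h1 t' ht', htt]
    rw [h2]
    refine ih (hq.cons m) fun t ht => ?_
    obtain ⟨t, htS, rfl⟩ := Finset.mem_image.1 ht
    simp [hS t (Finset.mem_filter.1 htS).1]

end IsSemimeasure

/-! ### Error and divergence of a protocol with coins, and their chain rules -/

namespace DetProtocol

section Masses

variable {first out : Player} {k : ℕ} {X Y Z A B : Type*} [Fintype A] [Fintype B]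

/-- The weight of the transcript `t` on input `(x, y)`, when the parties hold coins with the
weights `α x` and `β y`. -/
def transMass (P : DetProtocol first out k (X × A) (Y × B) Z) (α : X → A → ℝ) (β : Y → B → ℝ)
    (x : X) (y : Y) (t : History) : ℝ :=
  ∑ a, ∑ b, if P.transcript (x, a) (y, b) = t then α x a * β y b else 0

open scoped Classical in
/-- The weight of a wrong answer on input `(x, y)`. -/
def errMass (P : DetProtocol first out k (X × A) (Y × B) Z) (f : X → Y → Z) (α : X → A → ℝ)
    (β : Y → B → ℝ) (x : X) (y : Y) : ℝ :=
  ∑ a, ∑ b, if P.answer (x, a) (y, b) ≠ f x y then α x a * β y b else 0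

/-- The divergence (in nats, and not normalised) of the transcript on input `(x, y)` from the
prior `q`. -/
def infoMass (P : DetProtocol first out k (X × A) (Y × B) Z) (α : X → A → ℝ) (β : Y → B → ℝ)
    (q : History → ℝ) (x : X) (y : Y) : ℝ :=
  ∑ a, ∑ b, α x a * β y b *
    (Real.log (P.transMass α β x y (P.transcript (x, a) (y, b))) -
      Real.log ((∑ a, α x a) * ∑ b, β y b) -
      Real.log (q (P.transcript (x, a) (y, b))) + Real.log (q []))

/-- The bound on the error and the communication of the compressed protocol on input `(x, y)`. -/
def simBound (P : DetProtocol first out k (X × A) (Y × B) Z) (f : X → Y → Z) (α : X → A → ℝ)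
    (β : Y → B → ℝ) (q : History → ℝ) (lam η : ℝ) (x : X) (y : Y) : ℝ :=
  P.errMass f α β x y +
    lam * (4 / Real.log 2 * P.infoMass α β q x y + 14 * k * ((∑ a, α x a) * ∑ b, β y b)) +
    k * η * ((∑ a, α x a) * ∑ b, β y b)

variable {P : DetProtocol first out k (X × A) (Y × B) Z} {f : X → Y → Z} {α : X → A → ℝ}
  {β : Y → B → ℝ} {q : History → ℝ} {x : X} {y : Y}

lemma errMass_nonneg (hα : ∀ x a, 0 ≤ α x a) (hβ : ∀ y b, 0 ≤ β y b) :
    0 ≤ P.errMass f α β x y := by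
  refine Finset.sum_nonneg fun a _ => Finset.sum_nonneg fun b _ => ?_
  have := mul_nonneg (hα x a) (hβ y b)
  split_ifs <;> simp [this]

lemma le_transMass (hα : ∀ x a, 0 ≤ α x a) (hβ : ∀ y b, 0 ≤ β y b) (a : A) (b : B) :
    α x a * β y b ≤ P.transMass α β x y (P.transcript (x, a) (y, b)) := by
  unfold transMass
  rw [← Fintype.sum_prod_type']
  have h := Finset.single_le_sum (s := Finset.univ) (f := fun p : A × B =>
    if P.transcript (x, p.1) (y, p.2) = P.transcript (x, a) (y, b) then α x p.1 * β y p.2 else 0)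
    (fun p _ => by have := mul_nonneg (hα x p.1) (hβ y p.2); split_ifs <;> simp [this])
    (Finset.mem_univ (a, b))
  simpa using h

/-- Gibbs' inequality from `log u ≤ u - 1`. The prior may be a semimeasure: all that matters is that
its weights on the transcripts sum to at most `q []`, and `log (q [])` enters `infoMass` as the
normalisation. -/
lemma infoMass_nonneg (hα : ∀ x a, 0 ≤ α x a) (hβ : ∀ y b, 0 ≤ β y b) (hq : IsSemimeasure q)
    (habs : ∀ a b, 0 < α x a → 0 < β y b → 0 < q (P.transcript (x, a) (y, b))) :
    0 ≤ P.infoMass α β q x y := by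
  set N := (∑ a, α x a) * ∑ b, β y b with hN
  have hN' : N = ∑ a, ∑ b, α x a * β y b := by rw [hN, Finset.sum_mul_sum]
  have hN0 : 0 ≤ N := mul_nonneg (Finset.sum_nonneg fun a _ => hα x a)
    (Finset.sum_nonneg fun b _ => hβ y b)
  let T : A × B → History := fun p => P.transcript (x, p.1) (y, p.2)
  let w : A × B → ℝ := fun p => α x p.1 * β y p.2
  have hw : ∀ p, 0 ≤ w p := fun p => mul_nonneg (hα _ _) (hβ _ _)
  have htm : ∀ t, P.transMass α β x y t = ∑ p with T p = t, w p := by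
    intro t
    rw [transMass, Finset.sum_filter, ← Fintype.sum_prod_type']
  have hterm : ∀ p, w p - N * (w p / P.transMass α β x y (T p) * (q (T p) / q [])) ≤
      w p * (Real.log (P.transMass α β x y (T p)) - Real.log N - Real.log (q (T p)) +
        Real.log (q [])) := by
    intro p
    rcases (hw p).eq_or_lt with h0 | h0
    · simp [← h0]
    · have ha : 0 < α x p.1 := by
        rcases (hα x p.1).eq_or_lt with h | h
        · simp [w, ← h] at h0
        · exact h
      have hb : 0 < β y p.2 := by
        rcases (hβ y p.2).eq_or_lt with h | h
        · simp [w, ← h] at h0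
        · exact h
      have hqT : 0 < q (T p) := habs p.1 p.2 ha hb
      have hq0 : 0 < q [] := hqT.trans_le (hq.append_le [] (T p))
      have htr : 0 < P.transMass α β x y (T p) := h0.trans_le (le_transMass hα hβ p.1 p.2)
      have hNp : 0 < N := mul_pos
        (ha.trans_le (Finset.single_le_sum (fun a _ => hα x a) (Finset.mem_univ p.1)))
        (hb.trans_le (Finset.single_le_sum (fun b _ => hβ y b) (Finset.mem_univ p.2)))
      have hl := Real.log_le_sub_one_of_pos
        (show 0 < N * q (T p) / (P.transMass α β x y (T p) * q []) by positivity)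
      rw [Real.log_div (by positivity) (by positivity), Real.log_mul hNp.ne' hqT.ne',
        Real.log_mul htr.ne' hq0.ne'] at hl
      have := mul_le_mul_of_nonneg_left hl h0.le
      have e : w p * (N * q (T p) / (P.transMass α β x y (T p) * q []) - 1) =
          N * (w p / P.transMass α β x y (T p) * (q (T p) / q [])) - w p := by
        field_simp
      rw [e] at this
      linarith
  have hinfo : P.infoMass α β q x y = ∑ p, w p *
      (Real.log (P.transMass α β x y (T p)) - Real.log N - Real.log (q (T p)) +
        Real.log (q [])) := by
    rw [infoMass, ← Fintype.sum_prod_type']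
  have hsum : ∑ p, w p / P.transMass α β x y (T p) * (q (T p) / q []) ≤ 1 := by
    rw [← Finset.sum_fiberwise_of_maps_to (s := Finset.univ) (t := Finset.univ.image T) (g := T)
      (fun p _ => Finset.mem_image_of_mem _ (Finset.mem_univ p))]
    have h1 : ∀ t ∈ Finset.univ.image T,
        ∑ p with T p = t, w p / P.transMass α β x y (T p) * (q (T p) / q []) ≤ q t / q [] := by
      intro t _
      have h2 : ∀ p ∈ Finset.univ.filter (fun p => T p = t),
          w p / P.transMass α β x y (T p) * (q (T p) / q []) =
          w p * ((P.transMass α β x y t)⁻¹ * (q t / q [])) := by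
        intro p hp
        rw [(Finset.mem_filter.1 hp).2]
        ring
      rw [Finset.sum_congr rfl h2, ← Finset.sum_mul, ← htm, ← mul_assoc]
      exact mul_le_of_le_one_left (div_nonneg (hq.nonneg _) (hq.nonneg _)) mul_inv_le_one
    refine (Finset.sum_le_sum h1).trans ?_
    rw [← Finset.sum_div]
    refine div_le_one_of_le₀ (hq.sum_le_nil (n := k) fun t ht => ?_) (hq.nonneg _)
    obtain ⟨p, _, rfl⟩ := Finset.mem_image.1 ht
    exact P.length_transcript _ _
  rw [hinfo]
  refine le_trans ?_ (Finset.sum_le_sum fun p _ => hterm p)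
  rw [Finset.sum_sub_distrib, ← Finset.mul_sum, show ∑ p, w p = N by
    rw [hN', ← Fintype.sum_prod_type']]
  nlinarith

lemma simBound_nonneg {lam η : ℝ} (hlam : 0 ≤ lam) (hη : 0 ≤ η) (hα : ∀ x a, 0 ≤ α x a)
    (hβ : ∀ y b, 0 ≤ β y b) (hq : IsSemimeasure q)
    (habs : ∀ a b, 0 < α x a → 0 < β y b → 0 < q (P.transcript (x, a) (y, b))) :
    0 ≤ P.simBound f α β q lam η x y := by
  have h1 := errMass_nonneg (P := P) (f := f) (x := x) (y := y) hα hβ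
  have h2 := infoMass_nonneg hα hβ hq habs
  have h3 : 0 ≤ (∑ a, α x a) * ∑ b, β y b := mul_nonneg (Finset.sum_nonneg fun a _ => hα x a)
    (Finset.sum_nonneg fun b _ => hβ y b)
  have h4 : 0 < Real.log 2 := Real.log_pos (by norm_num)
  unfold simBound
  positivity

end Masses

section FirstMessage

variable {out : Player} {k : ℕ} {X Y Z A B : Type*} [Fintype X] [Fintype A] [Fintype B]

/-- The weights of Alice's coins, restricted to the event that her first message is `m`. -/
def restrict (P : DetProtocol .alice out (k + 1) (X × A) (Y × B) Z) (α : X → A → ℝ)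
    (m : List Bool) (x : X) (a : A) : ℝ :=
  if P.msgA [] (x, a) = m then α x a else 0

/-- The possible first messages of Alice. -/
def firstMessages (P : DetProtocol .alice out (k + 1) (X × A) (Y × B) Z) : Finset (List Bool) :=
  Finset.univ.image (P.msgA [])

variable (P : DetProtocol .alice out (k + 1) (X × A) (Y × B) Z) {f : X → Y → Z} {α : X → A → ℝ}
  {β : Y → B → ℝ} {q : History → ℝ} {x : X} {y : Y}

-- Every coin of Alice produces exactly one first message, so the restricted weights split `α x`.
omit [Fintype B] in
lemma sum_restrict (F : List Bool → A → ℝ) :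
    ∑ m ∈ P.firstMessages, ∑ a, P.restrict α m x a * F m a =
      ∑ a, α x a * F (P.msgA [] (x, a)) a := by
  rw [Finset.sum_comm]
  refine Finset.sum_congr rfl fun a _ => ?_
  rw [Finset.sum_eq_single (P.msgA [] (x, a))]
  · simp [restrict]
  · intro m _ hm
    simp [restrict, hm.symm]
  · intro h
    exact absurd (Finset.mem_image_of_mem _ (Finset.mem_univ _)) h

omit [Fintype B] in
lemma sum_total_restrict :
    ∑ m ∈ P.firstMessages, ∑ a, P.restrict α m x a = ∑ a, α x a := by
  simpa using P.sum_restrict (α := α) (x := x) fun _ _ => 1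

-- Restricting the coins instead of conditioning on the message keeps the masses unnormalised, and
-- no division appears.
omit [Fintype X] in
lemma transMass_restrict (m : List Bool) (t : History) :
    (P.tail m).transMass (P.restrict α m) β x y t = P.transMass α β x y (m :: t) := by
  unfold transMass
  refine Finset.sum_congr rfl fun a _ => Finset.sum_congr rfl fun b _ => ?_
  have hT := P.transcript_eq_cons (x, a) (y, b)
  have hm : P.msg (x, a) (y, b) 0 [] = P.msgA [] (x, a) := rfl
  rw [hm] at hT
  rw [hT, restrict]
  by_cases h : P.msgA [] (x, a) = m
  · simp [h]
  · simp [h]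

lemma errMass_eq_sum_tail :
    P.errMass f α β x y =
      ∑ m ∈ P.firstMessages, (P.tail m).errMass f (P.restrict α m) β x y := by
  classical
  have h := P.sum_restrict (α := α) (x := x) fun m a =>
    ∑ b, if (P.tail m).answer (x, a) (y, b) ≠ f x y then β y b else 0
  simp only [Finset.mul_sum, mul_ite, mul_zero] at h
  unfold errMass
  rw [h]
  refine Finset.sum_congr rfl fun a _ => Finset.sum_congr rfl fun b _ => ?_
  rw [P.answer_eq_tail]
  rfl

/-- The chain rule for the divergence of the transcript. -/
lemma infoMass_eq_sum_tail (hα : ∀ x a, 0 ≤ α x a) (hβ : ∀ y b, 0 ≤ β y b)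
    (hq : IsSemimeasure q)
    (habs : ∀ a b, 0 < α x a → 0 < β y b → 0 < q (P.transcript (x, a) (y, b))) :
    P.infoMass α β q x y =
      ∑ m ∈ P.firstMessages,
        (P.tail m).infoMass (P.restrict α m) β (fun h => q (m :: h)) x y +
      ((∑ a, α x a) * ∑ b, β y b) * ∑ m ∈ P.firstMessages,
        (∑ a, P.restrict α m x a) / (∑ a, α x a) *
          Real.log ((∑ a, P.restrict α m x a) / (∑ a, α x a) / (q [m] / q [])) := by
  have hS : ∀ a, α x a ≤ ∑ a, α x a := fun a =>
    Finset.single_le_sum (fun a _ => hα x a) (Finset.mem_univ a)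
  have hSβ : ∀ b, β y b ≤ ∑ b, β y b := fun b =>
    Finset.single_le_sum (fun b _ => hβ y b) (Finset.mem_univ b)
  have hr0 : ∀ m a, 0 ≤ P.restrict α m x a := fun m a => by
    unfold restrict
    split_ifs
    exacts [hα x a, le_rfl]
  have hS' : ∀ a, α x a ≤ ∑ a', P.restrict α (P.msgA [] (x, a)) x a' := fun a => by
    have := Finset.single_le_sum (fun a' _ => hr0 (P.msgA [] (x, a)) a') (Finset.mem_univ a)
    simpa [restrict] using this
  have h1 : ∑ m ∈ P.firstMessages,
        (P.tail m).infoMass (P.restrict α m) β (fun h => q (m :: h)) x y =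
      ∑ a, α x a * ∑ b, β y b *
        (Real.log ((P.tail (P.msgA [] (x, a))).transMass (P.restrict α (P.msgA [] (x, a))) β x y
            ((P.tail (P.msgA [] (x, a))).transcript (x, a) (y, b))) -
          Real.log ((∑ a', P.restrict α (P.msgA [] (x, a)) x a') * ∑ b, β y b) -
          Real.log (q (P.msgA [] (x, a) ::
            (P.tail (P.msgA [] (x, a))).transcript (x, a) (y, b))) +
          Real.log (q [P.msgA [] (x, a)])) := by
    rw [← P.sum_restrict (α := α) (x := x) fun m a => ∑ b, β y b *
        (Real.log ((P.tail m).transMass (P.restrict α m) β x y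
            ((P.tail m).transcript (x, a) (y, b))) -
          Real.log ((∑ a', P.restrict α m x a') * ∑ b, β y b) -
          Real.log (q (m :: (P.tail m).transcript (x, a) (y, b))) + Real.log (q [m]))]
    simp only [infoMass, Finset.mul_sum, mul_assoc]
  have h2 : ((∑ a, α x a) * ∑ b, β y b) * ∑ m ∈ P.firstMessages,
        (∑ a, P.restrict α m x a) / (∑ a, α x a) *
          Real.log ((∑ a, P.restrict α m x a) / (∑ a, α x a) / (q [m] / q [])) =
      ∑ a, α x a * ∑ b, β y b *
        Real.log ((∑ a', P.restrict α (P.msgA [] (x, a)) x a') / (∑ a, α x a) /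
          (q [P.msgA [] (x, a)] / q [])) := by
    rcases eq_or_ne (∑ a, α x a) 0 with h0 | h0
    · have : ∀ a, α x a = 0 := fun a => le_antisymm (h0 ▸ hS a) (hα x a)
      simp [this]
    · rw [← P.sum_restrict (α := α) (x := x) fun m a => ∑ b, β y b *
        Real.log ((∑ a', P.restrict α m x a') / (∑ a, α x a) / (q [m] / q [])), Finset.mul_sum]
      refine Finset.sum_congr rfl fun m _ => ?_
      rw [← Finset.sum_mul, ← Finset.sum_mul]
      field_simp
  rw [h1, h2, ← Finset.sum_add_distrib, infoMass]
  refine Finset.sum_congr rfl fun a _ => ?_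
  rw [← mul_add, ← Finset.sum_add_distrib]
  refine Eq.trans (Finset.sum_congr rfl fun b _ => ?_) (Finset.mul_sum _ _ _).symm
  rw [mul_assoc]
  rcases (hα x a).eq_or_lt with ha | ha
  · simp [← ha]
  rcases (hβ y b).eq_or_lt with hb | hb
  · simp [← hb]
  have hT := P.transcript_eq_cons (x, a) (y, b)
  rw [show P.msg (x, a) (y, b) 0 [] = P.msgA [] (x, a) from rfl] at hT
  have hqT := habs a b ha hb
  -- The transcript terms of the tail now coincide with those of `P`. What is left is a telescoping
  -- identity between the coin totals and the values of `q` before and after the first message.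
  rw [transMass_restrict, ← hT, ← mul_add]
  have hqm : 0 < q [P.msgA [] (x, a)] := by
    rw [hT] at hqT
    exact hqT.trans_le (hq.append_le [P.msgA [] (x, a)] _)
  have hq0 : 0 < q [] := hqm.trans_le (hq.append_le [] _)
  have e1 := (ha.trans_le (hS a)).ne'
  have e2 := (ha.trans_le (hS' a)).ne'
  have e3 := (hb.trans_le (hSβ b)).ne'
  rw [Real.log_div (div_ne_zero e2 e1) (div_ne_zero hqm.ne' hq0.ne'), Real.log_div e2 e1,
    Real.log_div hqm.ne' hq0.ne', Real.log_mul e1 e3, Real.log_mul e2 e3]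
  ring

end FirstMessage

end DetProtocol

end

/-! ### Compression of all rounds by induction -/

noncomputable section

open scoped Classical in
/-- Every protocol with the coin sets `A` and `B` can be compressed: for all weights `g` of the
inputs and all priors `q` there is a deterministic protocol whose weighted error and communication
are controlled by the error of the given protocol and its divergence from `q`. -/
def Compressible (first out : Player) (k : ℕ) {X Y Z : Type*} (A B : Type*) [Fintype X]
    [Fintype Y] [Fintype A] [Fintype B] (f : X → Y → Z) (lam η : ℝ) : Prop :=
  ∀ (P : DetProtocol first out k (X × A) (Y × B) Z) (α : X → A → ℝ) (β : Y → B → ℝ)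
    (q : History → ℝ) (g : X → Y → ℝ), (∀ x a, 0 ≤ α x a) → (∀ y b, 0 ≤ β y b) →
    (∀ x y, 0 ≤ g x y) → IsSemimeasure q →
    (∀ x y, 0 < g x y → ∀ a b, 0 < α x a → 0 < β y b → 0 < q (P.transcript (x, a) (y, b))) →
    ∃ Q : DetProtocol first out k X Y Z,
      ∑ x, ∑ y, g x y * ((∑ a, α x a) * ∑ b, β y b) *
        ((if Q.answer x y ≠ f x y then 1 else 0) + lam * Q.bits x y) ≤
      ∑ x, ∑ y, g x y * P.simBound f α β q lam η x y

section

variable {first out : Player} {k : ℕ} {X Y Z A B : Type*} [Fintype X]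
    [Fintype Y] [Fintype A] [Fintype B] {f : X → Y → Z} {lam η : ℝ}

namespace DetProtocol

omit [Fintype X] [Fintype Y] in
lemma swap_transMass (P : DetProtocol first out k (X × A) (Y × B) Z) (α : X → A → ℝ)
    (β : Y → B → ℝ) (x : X) (y : Y) (t : History) :
    P.swap.transMass β α y x t = P.transMass α β x y t := by
  unfold transMass
  rw [Finset.sum_comm]
  simp only [swap_transcript, mul_comm]

omit [Fintype X] [Fintype Y] in
lemma swap_simBound (P : DetProtocol first out k (X × A) (Y × B) Z) (α : X → A → ℝ)
    (β : Y → B → ℝ) (q : History → ℝ) (x : X) (y : Y) :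
    P.swap.simBound (flip f) β α q lam η y x = P.simBound f α β q lam η x y := by
  have h1 : P.swap.errMass (flip f) β α y x = P.errMass f α β x y := by
    unfold errMass
    rw [Finset.sum_comm]
    refine Finset.sum_congr rfl fun a _ => Finset.sum_congr rfl fun b _ => ?_
    rw [swap_answer, mul_comm]
    rfl
  have h2 : P.swap.infoMass β α q y x = P.infoMass α β q x y := by
    unfold infoMass
    rw [Finset.sum_comm]
    simp only [swap_transcript, swap_transMass, mul_comm (β y _) (α x _),
      mul_comm (∑ b, β y b) (∑ a, α x a)]
  rw [simBound, simBound, h1, h2, mul_comm (∑ b, β y b)]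

end DetProtocol

open DetProtocol

/-- By this symmetry it is enough to treat protocols in which Alice speaks first, or in which Alice
announces the answer. -/
lemma Compressible.swap (h : Compressible first.other out.other k B A (flip f) lam η) :
    Compressible first out k A B f lam η := by
  intro P α β q g hα hβ hg hq habs
  obtain ⟨Q, hQ⟩ := h P.swap β α q (flip g) hβ hα (fun y x => hg x y) hq
    (fun y x hxy b a hb ha => by
      rw [swap_transcript]
      exact habs x y hxy a b ha hb)
  have hS : ∃ Q' : DetProtocol first out k X Y Z, ∀ x y, Q'.answer x y = Q.answer y x ∧
      Q'.bits x y = Q.bits y x := by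
    have h1 : ∀ x y, Q.swap.answer x y = Q.answer y x ∧ Q.swap.bits x y = Q.bits y x :=
      fun x y => ⟨Q.swap_answer y x, Q.swap_bits y x⟩
    -- `Q.swap` has the players `first.other.other` and `out.other.other`, which reduce to `first`
    -- and `out` only for concrete players.
    cases first <;> cases out <;> exact ⟨Q.swap, h1⟩
  obtain ⟨Q', hQ'⟩ := hS
  refine ⟨Q', ?_⟩
  rw [Finset.sum_comm, Finset.sum_comm (f := fun x y => g x y * P.simBound f α β q lam η x y)]
  refine le_of_eq_of_le ?_ (hQ.trans_eq ?_)
  · refine Finset.sum_congr rfl fun y _ => Finset.sum_congr rfl fun x _ => ?_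
    rw [(hQ' x y).1, (hQ' x y).2, mul_comm (∑ a, α x a)]
    rfl
  · refine Finset.sum_congr rfl fun y _ => Finset.sum_congr rfl fun x _ => ?_
    rw [swap_simBound]
    rfl

/-- Averaging: the answer on the best coin does at least as well as a random coin. This removes the
coins of the party that answers. -/
lemma exists_mul_sum_le [Nonempty Z] (α : A → ℝ) (hα : ∀ a, 0 ≤ α a) (o : A → Z) (E : Z → ℝ) :
    ∃ z, (∑ a, α a) * E z ≤ ∑ a, α a * E (o a) := by
  rcases isEmpty_or_nonempty A with h | h
  · exact ⟨Classical.arbitrary Z, by simp⟩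
  · obtain ⟨a₀, _, ha₀⟩ := Finset.exists_min_image Finset.univ (fun a => E (o a))
      Finset.univ_nonempty
    refine ⟨o a₀, ?_⟩
    rw [Finset.sum_mul]
    exact Finset.sum_le_sum fun a _ => mul_le_mul_of_nonneg_left (ha₀ a (Finset.mem_univ a)) (hα a)

/-- Without messages the divergence vanishes and Alice's answer depends on `x` and her coin alone,
so for every `x` she can use the best answer against the weighted sum over `y`. -/
lemma compressible_zero_alice [Nonempty Z] : Compressible first .alice 0 A B f lam η := by
  classical
  intro P α β q g hα hβ hg hq habs
  have hT : ∀ x a y b, P.transcript (x, a) (y, b) = [] := fun _ _ _ _ => rfl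
  have hsb : ∀ x y, P.simBound f α β q lam η x y =
      ∑ a, α x a * ((∑ b, β y b) * if P.outA [] (x, a) ≠ f x y then 1 else 0) := by
    intro x y
    have h1 : P.infoMass α β q x y = 0 := by
      have : P.transMass α β x y [] = (∑ a, α x a) * ∑ b, β y b := by
        simp [transMass, hT, Finset.sum_mul_sum]
      simp [infoMass, hT, this]
    have h2 : P.errMass f α β x y =
        ∑ a, α x a * ((∑ b, β y b) * if P.outA [] (x, a) ≠ f x y then 1 else 0) := by
      unfold errMass
      refine Finset.sum_congr rfl fun a _ => ?_
      have : ∀ b, P.answer (x, a) (y, b) = P.outA [] (x, a) := fun _ => rfl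
      simp only [this]
      split_ifs <;> simp [Finset.mul_sum]
    simp [simBound, h1, h2]
  choose z hz using fun x => exists_mul_sum_le (α x) (hα x) (fun a => P.outA [] (x, a))
    fun z => ∑ y, g x y * ((∑ b, β y b) * if z ≠ f x y then 1 else 0)
  refine ⟨silent first .alice 0 z fun _ => Classical.arbitrary Z, ?_⟩
  have hans : ∀ x y, (silent first .alice 0 z fun _ : Y => Classical.arbitrary Z).answer x y =
      z x := fun _ _ => rfl
  simp only [silent_bits, hans, hsb, Nat.cast_zero, mul_zero, add_zero]
  refine Finset.sum_le_sum fun x _ => ?_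
  refine le_trans (le_of_eq ?_) ((hz x).trans (le_of_eq ?_))
  · rw [Finset.mul_sum]
    refine Finset.sum_congr rfl fun y _ => by ring
  · simp only [Finset.mul_sum]
    rw [Finset.sum_comm]
    refine Finset.sum_congr rfl fun y _ => Finset.sum_congr rfl fun a _ => by ring

lemma compressible_zero [Nonempty Z] : Compressible first out 0 A B f lam η := by
  cases out
  · exact compressible_zero_alice
  · exact Compressible.swap compressible_zero_alice

/-- The value chosen must also have positive weight, because the message code decodes to possible
messages only for such coins. -/
lemma exists_pos_weight_le {R : Type*} [Fintype R] {w : R → ℝ} (hw : ∀ r, 0 ≤ w r)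
    (hw1 : ∑ r, w r = 1) (F : R → ℝ) : ∃ r, 0 < w r ∧ F r ≤ ∑ r, w r * F r := by
  by_contra! h
  set c := ∑ r, w r * F r with hc
  obtain ⟨r₀, hr₀⟩ : ∃ r, 0 < w r := by
    by_contra! h'
    have : ∑ r, w r ≤ 0 := Finset.sum_nonpos fun r _ => h' r
    linarith
  have : ∑ r, w r * c < ∑ r, w r * F r := by
    refine Finset.sum_lt_sum (fun r _ => ?_) ⟨r₀, Finset.mem_univ _, ?_⟩
    · rcases (hw r).eq_or_lt with h0 | h0
      · simp [← h0]
      · exact mul_le_mul_of_nonneg_left (h r h0).le h0.le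
    · exact mul_lt_mul_of_pos_left (h r₀ hr₀) hr₀
  rw [← Finset.sum_mul, hw1, one_mul] at this
  exact lt_irrefl _ this

namespace DetProtocol

-- Error and divergence split over the first message, and one round is charged its divergence, the
-- overhead `14` and the failure probability `η`.
omit [Fintype Y] in
lemma simBound_eq_sum_tail (P : DetProtocol .alice out (k + 1) (X × A) (Y × B) Z)
    {α : X → A → ℝ} {β : Y → B → ℝ} {q : History → ℝ} {x : X} {y : Y}
    (hα : ∀ x a, 0 ≤ α x a) (hβ : ∀ y b, 0 ≤ β y b) (hq : IsSemimeasure q)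
    (habs : ∀ a b, 0 < α x a → 0 < β y b → 0 < q (P.transcript (x, a) (y, b))) :
    P.simBound f α β q lam η x y =
      ∑ m ∈ P.firstMessages,
        (P.tail m).simBound f (P.restrict α m) β (fun h => q (m :: h)) lam η x y +
      ((∑ a, α x a) * ∑ b, β y b) * (lam * (4 / Real.log 2 * ∑ m ∈ P.firstMessages,
        (∑ a, P.restrict α m x a) / (∑ a, α x a) *
          Real.log ((∑ a, P.restrict α m x a) / (∑ a, α x a) / (q [m] / q [])) + 14) + η) := by
  have h := P.sum_total_restrict (α := α) (x := x)
  simp only [simBound, Finset.sum_add_distrib, ← Finset.mul_sum, ← Finset.sum_mul]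
  rw [← errMass_eq_sum_tail, infoMass_eq_sum_tail P hα hβ hq habs, h]
  push_cast
  ring

end DetProtocol

end

end

noncomputable section

section

variable {first out : Player} {k : ℕ} {X Y Z A B : Type*} [Fintype X]
    [Fintype Y] [Fintype A] [Fintype B] {f : X → Y → Z} {lam η : ℝ}

open DetProtocol

lemma sum_comm_four {ι₁ ι₂ ι₃ ι₄ : Type*} [Fintype ι₁] [Fintype ι₂] [Fintype ι₃] [Fintype ι₄]
    (F : ι₁ → ι₂ → ι₃ → ι₄ → ℝ) :
    ∑ x, ∑ y, ∑ u, ∑ v, F x y u v = ∑ u, ∑ v, ∑ x, ∑ y, F x y u v := by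
  have h := Finset.sum_comm (s := (Finset.univ : Finset (ι₁ × ι₂)))
    (t := (Finset.univ : Finset (ι₃ × ι₄))) (f := fun p r => F p.1 p.2 r.1 r.2)
  simpa only [Fintype.sum_prod_type] using h

-- Alice sends the compressed index of her first message; each index, with the message it stands
-- for, is continued by a protocol from the induction hypothesis for the tail. The choice of the
-- shared coins comes last, by averaging a bound that covers code length, failures and tails
-- together.
open scoped Classical in
lemma compressible_succ_alice [Nonempty Z] (hlam : 0 ≤ lam) (hη : 0 < η)
    (ih : Compressible (Player.other .alice) out k A B f lam η) :
    Compressible .alice out (k + 1) A B f lam η := by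
  intro P α β q g hα hβ hg hq habs
  let sα : X → ℝ := fun x => ∑ a, α x a
  let sβ : Y → ℝ := fun y => ∑ b, β y b
  let sr : X → List Bool → ℝ := fun x m => ∑ a, P.restrict α m x a
  let pr : X → List Bool → ℝ := fun x m => sr x m / sα x
  let F : List Bool → X → Y → ℝ := fun m x y =>
    (P.tail m).simBound f (P.restrict α m) β (fun h => q (m :: h)) lam η x y
  let G : X → Prop := fun x => ∃ y, 0 < g x y ∧ 0 < sα x ∧ 0 < sβ y
  let p : X → Option P.firstMessages → ℝ := fun x o => o.elim 0 fun m => pr x m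
  -- The weights `q [m] / q []` may sum to less than `1`; the extra symbol `none` takes the deficit
  -- and has probability `0` under every `p x`.
  let q₁ : Option P.firstMessages → ℝ := fun o =>
    o.elim (1 - ∑ m ∈ P.firstMessages, q [m] / q []) fun m => q [m] / q []
  have hsα : ∀ x, 0 ≤ sα x := fun x => Finset.sum_nonneg fun a _ => hα x a
  have hsβ : ∀ y, 0 ≤ sβ y := fun y => Finset.sum_nonneg fun b _ => hβ y b
  have hr0 : ∀ m x a, 0 ≤ P.restrict α m x a := fun m x a => by
    unfold restrict
    split_ifs
    exacts [hα x a, le_rfl]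
  have hsr : ∀ x m, 0 ≤ sr x m := fun x m => Finset.sum_nonneg fun a _ => hr0 m x a
  have hpr : ∀ x m, 0 ≤ pr x m := fun x m => div_nonneg (hsr x m) (hsα x)
  have hrT : ∀ m x a y b, 0 < P.restrict α m x a →
      0 < α x a ∧ P.transcript (x, a) (y, b) = m :: (P.tail m).transcript (x, a) (y, b) := by
    intro m x a y b h
    have hT := P.transcript_eq_cons (x, a) (y, b)
    rw [show P.msg (x, a) (y, b) 0 [] = P.msgA [] (x, a) from rfl] at hT
    unfold restrict at h
    split_ifs at h with hm
    · rw [hm] at hT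
      exact ⟨h, hT⟩
    · exact absurd h (lt_irrefl _)
  have hF0 : ∀ m x y, 0 < g x y → 0 ≤ F m x y := fun m x y hxy =>
    simBound_nonneg hlam hη.le (hr0 m) hβ (hq.cons m) fun a b ha hb => by
      obtain ⟨ha', hT⟩ := hrT m x a y b ha
      rw [← hT]
      exact habs x y hxy a b ha' hb
  -- the code for the first message
  obtain ⟨N, w, hw0, hw1, hpos, hcode⟩ := exists_message_code G p (q := q₁) (η := η)
    (by
      rintro (_ | m)
      · have : ∑ m ∈ P.firstMessages, q [m] / q [] ≤ 1 := by
          rw [← Finset.sum_div]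
          exact div_le_one_of_le₀ (hq.sum_le [] _) (hq.nonneg _)
        exact sub_nonneg.2 this
      · exact div_nonneg (hq.nonneg _) (hq.nonneg _))
    (by
      rw [Fintype.sum_option]
      simp only [q₁, Option.elim]
      rw [Finset.sum_coe_sort P.firstMessages fun m => q [m] / q []]
      ring)
    (by
      rintro x - (_ | m)
      · exact le_rfl
      · exact hpr x m)
    (by
      rintro x ⟨y, _, h, _⟩
      rw [Fintype.sum_option]
      simp only [p, Option.elim]
      rw [Finset.sum_coe_sort P.firstMessages fun m => pr x m, zero_add, ← Finset.sum_div,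
        P.sum_total_restrict]
      exact div_self h.ne')
    (by
      rintro x ⟨y, hxy, h, hy⟩ (_ | m) hm
      · exact absurd hm (lt_irrefl _)
      · have hs : 0 < sr x m := by
          rcases (hsr x m).eq_or_lt with h0 | h0
          · simp [p, pr, ← h0] at hm
          · exact h0
        obtain ⟨a, _, ha⟩ := Finset.exists_lt_of_sum_lt (s := Finset.univ) (f := fun _ => (0 : ℝ))
          (g := fun a => P.restrict α m x a) (by simpa using hs)
        obtain ⟨b, _, hb⟩ := Finset.exists_lt_of_sum_lt (s := Finset.univ) (f := fun _ => (0 : ℝ))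
          (g := fun b => β y b) (by simpa using hy)
        obtain ⟨ha', hT⟩ := hrT m x a y b ha
        have hqT := habs x y hxy a b ha' hb
        rw [hT] at hqT
        have hqm : 0 < q [(m : List Bool)] := hqT.trans_le (hq.append_le [(m : List Bool)] _)
        exact div_pos hqm (hqm.trans_le (hq.append_le [] _)))
    hη
  -- the protocols after the first message
  let g' : (Fin N → Option P.firstMessages) × (X → Option (Fin N)) → Fin N → List Bool →
      X → Y → ℝ := fun r j m x y => if r.2 x = some j then g x y / pr x m else 0
  have hg' : ∀ r j m x y, 0 ≤ g' r j m x y := fun r j m x y => by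
    simp only [g']
    split_ifs
    exacts [div_nonneg (hg x y) (hpr x m), le_rfl]
  have hIH : ∀ r j m, ∃ Q : DetProtocol (Player.other .alice) out k X Y Z,
      ∑ x, ∑ y, g' r j m x y * (sr x m * sβ y) *
        ((if Q.answer x y ≠ f x y then 1 else 0) + lam * Q.bits x y) ≤
      ∑ x, ∑ y, g' r j m x y * F m x y := by
    intro r j m
    refine ih (P.tail m) (P.restrict α m) β (fun h => q (m :: h)) (g' r j m) (hr0 m) hβ
      (hg' r j m) (hq.cons m) ?_
    intro x y hxy a b ha hb
    have hgxy : 0 < g x y := by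
      rcases (hg x y).eq_or_lt with h0 | h0
      · simp [g', ← h0] at hxy
      · exact h0
    obtain ⟨ha', hT⟩ := hrT m x a y b ha
    rw [← hT]
    exact habs x y hgxy a b ha' hb
  choose Q hQ using hIH
  let Q₀ : DetProtocol (Player.other .alice) out k X Y Z :=
    silent _ _ _ (fun _ => Classical.arbitrary Z) fun _ => Classical.arbitrary Z
  let Qc : (Fin N → Option P.firstMessages) × (X → Option (Fin N)) → Option (Fin N) →
      DetProtocol (Player.other .alice) out k X Y Z := fun r o =>
    o.elim Q₀ fun j => (r.1 j).elim Q₀ fun m => Q r j m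
  -- The charge for fixed shared coins `r`: the bits of the index, a full error in case of failure,
  -- and the bound of the tail for the decoded message.
  let bd : (Fin N → Option P.firstMessages) × (X → Option (Fin N)) → X → Y → ℝ := fun r x y =>
    g x y * (sα x * sβ y) * (lam * (indexCode (r.2 x)).length) +
    g x y * (sα x * sβ y) * (if r.2 x = none then 1 else 0) +
    ∑ m : P.firstMessages, if (r.2 x).map r.1 = some (some m) then g x y / pr x m * F m x y else 0
  have hbd : ∀ r, 0 < w r → ∑ x, ∑ y, g x y * (sα x * sβ y) *
      ((if (Qc r (r.2 x)).answer x y ≠ f x y then 1 else 0) +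
        lam * (((indexCode (r.2 x)).length : ℝ) + (Qc r (r.2 x)).bits x y)) ≤
      ∑ x, ∑ y, bd r x y := by
    intro r hr
    have h1 : ∀ x y, g x y * (sα x * sβ y) *
        ((if (Qc r (r.2 x)).answer x y ≠ f x y then 1 else 0) +
        lam * (((indexCode (r.2 x)).length : ℝ) + (Qc r (r.2 x)).bits x y)) ≤
        g x y * (sα x * sβ y) * (lam * (indexCode (r.2 x)).length) +
        g x y * (sα x * sβ y) * (if r.2 x = none then 1 else 0) +
        ∑ j, ∑ m : P.firstMessages, if r.1 j = some m then g' r j m x y * (sr x m * sβ y) *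
          ((if (Q r j m).answer x y ≠ f x y then 1 else 0) + lam * (Q r j m).bits x y) else 0 := by
      intro x y
      have hgN : 0 ≤ g x y * (sα x * sβ y) := mul_nonneg (hg x y) (mul_nonneg (hsα x) (hsβ y))
      cases hx : r.2 x with
      | none =>
        have e1 : ∀ j m, g' r j m x y = 0 := fun j m => by simp [g', hx]
        have e2 : (Qc r none).bits x y = 0 := silent_bits _ _ x y
        have e3 : (if (Qc r none).answer x y ≠ f x y then 1 else 0 : ℝ) ≤ 1 := by
          split_ifs <;> norm_num
        simp only [e1, e2, zero_mul, ite_self, Finset.sum_const_zero, add_zero, if_true,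
          Nat.cast_zero]
        rw [← mul_add]
        exact mul_le_mul_of_nonneg_left (by linarith) hgN
      | some j =>
        cases hj : r.1 j with
        | none =>
          have := hpos r hr x j hx
          rw [hj] at this
          exact absurd this (lt_irrefl _)
        | some m =>
          have hp := hpos r hr x j hx
          rw [hj] at hp
          change 0 < pr x m at hp
          have e1 : sr x m ≠ 0 := fun h0 => by simp [pr, h0] at hp
          have e2 : sα x ≠ 0 := fun h0 => by simp [pr, h0] at hp
          rw [Finset.sum_eq_single j, Finset.sum_eq_single m]
          · have e3 : Qc r (some j) = Q r j m := by simp [Qc, hj]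
            -- The division by `pr x m` in `g'` makes up for the smaller total of the restricted
            -- coins.
            have e4 : g' r j m x y * (sr x m * sβ y) = g x y * (sα x * sβ y) := by
              simp only [g', hx, if_true, pr]
              field_simp
            rw [e3, e4, if_pos hj]
            simp only [reduceCtorEq, if_false, mul_zero, add_zero]
            apply le_of_eq
            ring
          · intro m' _ hm'
            rw [hj, if_neg (by simpa using hm'.symm)]
          · intro h
            exact absurd (Finset.mem_univ _) h
          · intro j' _ hj'
            have : ∀ m, g' r j' m x y = 0 := fun m => by simp [g', hx, hj'.symm]
            simp [this]
          · intro h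
            exact absurd (Finset.mem_univ _) h
    refine (Finset.sum_le_sum fun x _ => Finset.sum_le_sum fun y _ => h1 x y).trans ?_
    have hswap : ∀ H : Fin N → P.firstMessages → X → Y → ℝ,
        ∑ x, ∑ y, ∑ j, ∑ m : P.firstMessages, (if r.1 j = some m then H j m x y else 0) =
        ∑ j, ∑ m : P.firstMessages, if r.1 j = some m then ∑ x, ∑ y, H j m x y else 0 := by
      intro H
      have : ∀ j (m : P.firstMessages), (if r.1 j = some m then ∑ x, ∑ y, H j m x y else 0) =
          ∑ x, ∑ y, if r.1 j = some m then H j m x y else 0 := fun j m => by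
        split_ifs <;> simp
      simp only [this]
      exact sum_comm_four fun x y j m => if r.1 j = some m then H j m x y else 0
    have h2 : ∀ x y, ∑ m : P.firstMessages,
        (if (r.2 x).map r.1 = some (some m) then g x y / pr x m * F m x y else 0) =
        ∑ j, ∑ m : P.firstMessages, if r.1 j = some m then g' r j m x y * F m x y else 0 := by
      intro x y
      rw [Finset.sum_comm]
      refine Finset.sum_congr rfl fun m _ => ?_
      cases hx : r.2 x with
      | none => simp [g', hx]
      | some j =>
        rw [Finset.sum_eq_single j]
        · simp [g', hx]
        · intro j' _ hj'
          simp [g', hx, hj'.symm]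
        · intro h
          exact absurd (Finset.mem_univ _) h
    simp only [bd, Finset.sum_add_distrib, h2, hswap]
    refine add_le_add le_rfl (Finset.sum_le_sum fun j _ => Finset.sum_le_sum fun m _ => ?_)
    split_ifs
    · exact hQ r j m
    · exact le_rfl
  -- On average over `r` each part of `bd` is bounded input by input, and the chain rule for
  -- `simBound` puts the parts together.
  have havg : ∑ r, w r * ∑ x, ∑ y, bd r x y ≤
      ∑ x, ∑ y, g x y * P.simBound f α β q lam η x y := by
    simp only [Finset.mul_sum]
    rw [Finset.sum_comm]
    refine Finset.sum_le_sum fun x _ => ?_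
    rw [Finset.sum_comm]
    refine Finset.sum_le_sum fun y _ => ?_
    rcases (hg x y).eq_or_lt with hg0 | hg0
    · simp [bd, ← hg0]
    have hsb0 : 0 ≤ P.simBound f α β q lam η x y :=
      simBound_nonneg hlam hη.le hα hβ hq (habs x y hg0)
    rcases (hsα x).eq_or_lt with ha0 | ha0
    · have e1 : ∀ m, pr x m = 0 := fun m => by simp [pr, ← ha0]
      have : ∀ r, bd r x y = 0 := fun r => by simp [bd, ← ha0, e1]
      simp only [this, mul_zero, Finset.sum_const_zero]
      positivity
    rcases (hsβ y).eq_or_lt with hb0 | hb0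
    · have e1 : ∀ b, β y b = 0 := fun b => le_antisymm
        (hb0 ▸ Finset.single_le_sum (fun b _ => hβ y b) (Finset.mem_univ b)) (hβ y b)
      have e2 : ∀ m, F m x y = 0 := fun m => by
        simp [F, simBound, errMass, infoMass, e1]
      have : ∀ r, bd r x y = 0 := fun r => by simp [bd, ← hb0, e2]
      simp only [this, mul_zero, Finset.sum_const_zero]
      positivity
    obtain ⟨hout, hnone, hlen⟩ := hcode x ⟨y, hg0, ha0, hb0⟩
    have hsplit : ∑ r, w r * bd r x y =
        g x y * (sα x * sβ y) * (lam * ∑ r, w r * ((indexCode (r.2 x)).length : ℝ)) +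
        g x y * (sα x * sβ y) * (∑ r, w r * if r.2 x = none then 1 else 0) +
        ∑ m : P.firstMessages, g x y * (F m x y / pr x m *
          ∑ r, w r * if (r.2 x).map r.1 = some (some m) then 1 else 0) := by
      simp only [bd, mul_add, Finset.sum_add_distrib, Finset.mul_sum]
      congr 1
      · congr 1
        · exact Finset.sum_congr rfl fun r _ => by ring
        · exact Finset.sum_congr rfl fun r _ => by ring
      · rw [Finset.sum_comm]
        refine Finset.sum_congr rfl fun m _ => Finset.sum_congr rfl fun r _ => ?_
        split_ifs <;> ring
    -- The message `m` is decoded with probability at most `pr x m`, which cancels the denominator.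
    -- Since this is only an upper bound, `F m x y ≥ 0` is needed.
    have hFm : ∀ m : P.firstMessages, g x y * (F m x y / pr x m *
          ∑ r, w r * if (r.2 x).map r.1 = some (some m) then 1 else 0) ≤ g x y * F m x y := by
      intro m
      refine mul_le_mul_of_nonneg_left ?_ hg0.le
      have h1 := mul_le_mul_of_nonneg_left (hout (some m))
        (div_nonneg (hF0 m x y hg0) (hpr x m))
      refine h1.trans ?_
      change F m x y / pr x m * pr x m ≤ F m x y
      rcases eq_or_ne (pr x m) 0 with h0 | h0
      · rw [h0, mul_zero]
        exact hF0 m x y hg0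
      · rw [div_mul_cancel₀ _ h0]
    have hdiv : ∑ o, p x o * Real.log (p x o / q₁ o) =
        ∑ m ∈ P.firstMessages, pr x m * Real.log (pr x m / (q [m] / q [])) := by
      rw [Fintype.sum_option]
      simp only [p, q₁, Option.elim, zero_mul, zero_add]
      exact Finset.sum_coe_sort P.firstMessages
        fun m => pr x m * Real.log (pr x m / (q [m] / q []))
    rw [hdiv] at hlen
    rw [hsplit, simBound_eq_sum_tail P hα hβ hq (habs x y hg0), mul_add]
    have hFs : ∑ m : P.firstMessages, g x y * (F m x y / pr x m *
          ∑ r, w r * if (r.2 x).map r.1 = some (some m) then 1 else 0) ≤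
        g x y * ∑ m ∈ P.firstMessages, F m x y := by
      rw [← Finset.sum_coe_sort P.firstMessages fun m => F m x y, Finset.mul_sum]
      exact Finset.sum_le_sum fun m _ => hFm m
    have hgN : 0 ≤ g x y * (sα x * sβ y) := by positivity
    have h1 := mul_le_mul_of_nonneg_left (mul_le_mul_of_nonneg_left hlen hlam) hgN
    have h2 := mul_le_mul_of_nonneg_left hnone hgN
    calc _ ≤ g x y * (sα x * sβ y) * (lam * (4 / Real.log 2 *
          ∑ m ∈ P.firstMessages, pr x m * Real.log (pr x m / (q [m] / q [])) + 14)) +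
          g x y * (sα x * sβ y) * η + g x y * ∑ m ∈ P.firstMessages, F m x y :=
        add_le_add (add_le_add h1 h2) hFs
      _ = _ := by
        simp only [F, sα, sβ, pr, sr]
        ring
  obtain ⟨r, hr, hle⟩ := exists_pos_weight_le hw0 hw1 fun r => ∑ x, ∑ y, bd r x y
  refine ⟨prependAlice indexCode indexCode_prefix r.2 (Qc r), ?_⟩
  refine le_trans (le_of_eq ?_) ((hbd r hr).trans (hle.trans havg))
  refine Finset.sum_congr rfl fun x _ => Finset.sum_congr rfl fun y _ => ?_
  rw [prependAlice_answer, prependAlice_bits]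
  push_cast
  rfl

/-- **Message compression** for protocols with any number of rounds. -/
theorem compressible [Nonempty Z] (hlam : 0 ≤ lam) (hη : 0 < η) :
    Compressible first out k A B f lam η := by
  induction k generalizing first out with
  | zero => exact compressible_zero
  | succ k ih =>
    cases first
    · exact compressible_succ_alice hlam hη ih
    -- The second swap brings the tail back to the coin sets `A`, `B` and the function `f`, for
    -- which the induction hypothesis is stated.
    · refine Compressible.swap (compressible_succ_alice hlam hη (Compressible.swap ?_))
      have h : out.other.other = out := Player.other_other out
      rw [h]
      exact ih

end

end

noncomputable section

/-! ### Independent instances and resampling of one coordinate -/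

section DirectSum

variable {m : ℕ} {X Y K A B : Type*}

/-- The weight of the inputs `p.1` and the coin `p.2` of one party, when the `j`-th input has the
distribution `ν (d j)`. -/
def coinWeight (ν : K → X → ℝ) (c : A → ℝ) (d : Fin m → K) (p : (Fin m → X) × A) : ℝ :=
  (∏ j, ν (d j) (p.1 j)) * c p.2

/-- Replace the `i`-th input of one party. -/
def setInput (i : Fin m) (x : X) (p : (Fin m → X) × A) : (Fin m → X) × A :=
  (Function.update p.1 i x, p.2)

lemma setInput_self (i : Fin m) (p : (Fin m → X) × A) : setInput i (p.1 i) p = p := by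
  simp [setInput]

lemma setInput_apply (i : Fin m) (x : X) (p : (Fin m → X) × A) : (setInput i x p).1 i = x := by
  simp [setInput]

lemma setInput_setInput (i : Fin m) (x x' : X) (p : (Fin m → X) × A) :
    setInput i x (setInput i x' p) = setInput i x p := by
  simp [setInput]

lemma coinWeight_nonneg {ν : K → X → ℝ} {c : A → ℝ} (hν : ∀ e x, 0 ≤ ν e x) (hc : ∀ a, 0 ≤ c a)
    (d : Fin m → K) (p : (Fin m → X) × A) : 0 ≤ coinWeight ν c d p :=
  mul_nonneg (Finset.prod_nonneg fun _ _ => hν _ _) (hc _)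

variable [Fintype X] [Fintype Y] [Fintype A] [Fintype B]

lemma sum_coinWeight {ν : K → X → ℝ} {c : A → ℝ} (hν : ∀ e, ∑ x, ν e x = 1) (hc : ∑ a, c a = 1)
    (d : Fin m → K) : ∑ p, coinWeight ν c d p = 1 := by
  rw [Fintype.sum_prod_type]
  simp only [coinWeight, ← Finset.mul_sum, hc, mul_one]
  exact sum_prod_pi_eq_one fun j => hν (d j)

/-- Overwriting the `i`-th input by a sample from `ν e` amounts to changing the `i`-th index to `e`.
-/
lemma sum_coinWeight_setInput {ν : K → X → ℝ} {c : A → ℝ} (hν : ∀ e, ∑ x, ν e x = 1)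
    (d : Fin m → K) (i : Fin m) (e : K) (G : (Fin m → X) × A → ℝ) :
    ∑ x, ν e x * ∑ p, coinWeight ν c d p * G (setInput i x p) =
      ∑ p, coinWeight ν c (Function.update d i e) p * G p := by
  have h := sum_prod_pi_resample (fun j => ν (d j)) i (hν (d i)) (ν e)
    fun u => ∑ a, c a * G (u, a)
  have e1 : ∀ j, Function.update (fun j => ν (d j)) i (ν e) j =
      ν (Function.update d i e j) := by
    intro j
    by_cases hj : j = i
    · subst hj
      simp
    · simp [Function.update_of_ne hj]
  simp only [e1] at h
  rw [Fintype.sum_prod_type]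
  simp only [coinWeight, mul_assoc, ← Finset.mul_sum]
  rw [← h]
  simp only [Fintype.sum_prod_type, setInput, Finset.mul_sum]
  rw [Finset.sum_comm]
  refine Finset.sum_congr rfl fun u _ => Finset.sum_congr rfl fun x _ =>
    Finset.sum_congr rfl fun a _ => by ring

/-- The expectation of `G` over the inputs and the coins of both parties. -/
def jointMean (νX : K → X → ℝ) (νY : K → Y → ℝ) (cA : A → ℝ) (cB : B → ℝ) (d : Fin m → K)
    (G : (Fin m → X) × A → (Fin m → Y) × B → ℝ) : ℝ :=
  ∑ p, ∑ r, coinWeight νX cA d p * coinWeight νY cB d r * G p r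

variable {νX : K → X → ℝ} {νY : K → Y → ℝ} {cA : A → ℝ} {cB : B → ℝ}

section

variable (hX : ∀ e, νX e ∈ stdSimplex ℝ X) (hY : ∀ e, νY e ∈ stdSimplex ℝ Y)
  (hA : cA ∈ stdSimplex ℝ A) (hB : cB ∈ stdSimplex ℝ B) (d : Fin m → K)

include hX hY

lemma jointMean_setInput (i : Fin m) (e : K) (G : (Fin m → X) × A → (Fin m → Y) × B → ℝ) :
    ∑ x, ∑ y, νX e x * νY e y *
      jointMean νX νY cA cB d (fun p r => G (setInput i x p) (setInput i y r)) =
    jointMean νX νY cA cB (Function.update d i e) G := by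
  have h1 : ∀ p : (Fin m → X) × A, ∑ y, νY e y * ∑ r, coinWeight νY cB d r *
      G p (setInput i y r) = ∑ r, coinWeight νY cB (Function.update d i e) r * G p r :=
    fun p => sum_coinWeight_setInput (fun e => (hY e).2) d i e (G p)
  have h2 := sum_coinWeight_setInput (c := cA) (fun e => (hX e).2) d i e
    fun p => ∑ r, coinWeight νY cB (Function.update d i e) r * G p r
  unfold jointMean
  simp only [mul_assoc, ← Finset.mul_sum]
  rw [← h2]
  refine Finset.sum_congr rfl fun x _ => ?_
  congr 1
  simp only [← h1, Finset.mul_sum]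
  rw [Finset.sum_comm]
  refine Finset.sum_congr rfl fun p _ => Finset.sum_congr rfl fun y _ =>
    Finset.sum_congr rfl fun r _ => by ring

/-- Once the `i`-th inputs are overwritten, the index `d i` has no influence. -/
lemma jointMean_setInput_update (i : Fin m) (e : K) (x : X) (y : Y)
    (G : (Fin m → X) × A → (Fin m → Y) × B → ℝ) :
    jointMean νX νY cA cB (Function.update d i e)
      (fun p r => G (setInput i x p) (setInput i y r)) =
    jointMean νX νY cA cB d (fun p r => G (setInput i x p) (setInput i y r)) := by
  rw [← jointMean_setInput hX hY d i e]
  simp only [setInput_setInput, ← Finset.sum_mul, ← Finset.mul_sum]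
  rw [(hX e).2, (hY e).2, one_mul, one_mul]

include hA hB

lemma jointMean_one : jointMean νX νY cA cB d (fun _ _ => 1) = 1 := by
  unfold jointMean
  simp only [mul_one, ← Finset.mul_sum]
  rw [sum_coinWeight (fun e => (hY e).2) hB.2]
  simp [sum_coinWeight (fun e => (hX e).2) hA.2]

-- Given `d` the input pairs of different coordinates are independent, so the mean of a product over
-- coordinates factorises. The information bound rests on this.
omit hX hY in
lemma jointMean_prod (φ : Fin m → X → Y → ℝ) :
    jointMean νX νY cA cB d (fun p r => ∏ j, φ j (p.1 j) (r.1 j)) =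
      ∏ j, ∑ x, ∑ y, νX (d j) x * νY (d j) y * φ j x y := by
  have h1 := sum_prod_pi fun (j : Fin m) (z : X × Y) =>
    νX (d j) z.1 * νY (d j) z.2 * φ j z.1 z.2
  simp only [Fintype.sum_prod_type] at h1
  rw [← h1, jointMean,
    ← (Equiv.arrowProdEquivProdArrow (Fin m) (fun _ => X) fun _ => Y).symm.sum_comp,
    Fintype.sum_prod_type, Fintype.sum_prod_type]
  refine Finset.sum_congr rfl fun u _ => ?_
  simp only [Fintype.sum_prod_type]
  rw [Finset.sum_comm]
  refine Finset.sum_congr rfl fun v _ => ?_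
  simp only [coinWeight, Equiv.arrowProdEquivProdArrow_symm_apply, Finset.prod_mul_distrib]
  have : ∀ a b, (∏ j, νX (d j) (u j)) * cA a * ((∏ j, νY (d j) (v j)) * cB b) *
      ∏ j, φ j (u j) (v j) = cA a * (cB b * ((∏ j, νX (d j) (u j)) * (∏ j, νY (d j) (v j)) *
      ∏ j, φ j (u j) (v j))) := fun a b => by ring
  simp only [this, ← Finset.mul_sum, ← Finset.sum_mul, hA.2, hB.2, one_mul]

end

end DirectSum

end

noncomputable section

/-! ### Planting one instance, and information about single coordinates -/

namespace DetProtocol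

variable {first out : Player} {k m : ℕ} {X Y Z K A B : Type*}

/-- Solve one instance of a problem with a protocol for `m` instances: the input is used as the
`i`-th instance, and the other instances come from the coins. -/
def embed (P : DetProtocol first out k ((Fin m → X) × A) ((Fin m → Y) × B) (Fin m → Z))
    (i : Fin m) :
    DetProtocol first out k (X × ((Fin m → X) × A)) (Y × ((Fin m → Y) × B)) Z :=
  P.comap (fun z => setInput i z.1 z.2) (fun z => setInput i z.1 z.2) fun z => z i

variable (P : DetProtocol first out k ((Fin m → X) × A) ((Fin m → Y) × B) (Fin m → Z))

lemma embed_transcript (i : Fin m) (x : X) (y : Y) (p : (Fin m → X) × A)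
    (r : (Fin m → Y) × B) : (P.embed i).transcript (x, p) (y, r) =
      P.transcript (setInput i x p) (setInput i y r) :=
  P.comap_transcript _ _ _ _ _

lemma embed_answer (i : Fin m) (x : X) (y : Y) (p : (Fin m → X) × A)
    (r : (Fin m → Y) × B) : (P.embed i).answer (x, p) (y, r) =
      P.answer (setInput i x p) (setInput i y r) i :=
  P.comap_answer _ _ _ _ _

variable [Fintype X] [Fintype Y] [Fintype A] [Fintype B]

/-- The distribution of the history, when the inputs are drawn according to `d`. -/
def prior (νX : K → X → ℝ) (νY : K → Y → ℝ) (cA : A → ℝ) (cB : B → ℝ) (d : Fin m → K)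
    (h : History) : ℝ :=
  jointMean νX νY cA cB d fun p r => if P.history p r h.length = h then 1 else 0

/-- The probability of the transcript `t`, when the `i`-th inputs are `x` and `y`, and the other
inputs are drawn according to `d`. -/
def coordMass (νX : K → X → ℝ) (νY : K → Y → ℝ) (cA : A → ℝ) (cB : B → ℝ) (d : Fin m → K)
    (i : Fin m) (x : X) (y : Y) (t : History) : ℝ :=
  jointMean νX νY cA cB d fun p r =>
    if P.transcript (setInput i x p) (setInput i y r) = t then 1 else 0

/-- The mutual information (in nats) of the transcript and the `i`-th inputs, when the inputs are
drawn according to `d`. -/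
def coordInfo (νX : K → X → ℝ) (νY : K → Y → ℝ) (cA : A → ℝ) (cB : B → ℝ) (i : Fin m)
    (d : Fin m → K) : ℝ :=
  jointMean νX νY cA cB d fun p r =>
    Real.log (P.coordMass νX νY cA cB d i (p.1 i) (r.1 i) (P.transcript p r)) -
      Real.log (P.prior νX νY cA cB d (P.transcript p r))

variable {νX : K → X → ℝ} {νY : K → Y → ℝ} {cA : A → ℝ} {cB : B → ℝ}

lemma embed_transMass (d : Fin m → K) (i : Fin m) (x : X) (y : Y) (t : History) :
    (P.embed i).transMass (fun _ => coinWeight νX cA d) (fun _ => coinWeight νY cB d) x y t =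
      P.coordMass νX νY cA cB d i x y t := by
  simp only [transMass, coordMass, jointMean, embed_transcript, mul_ite, mul_one, mul_zero]

lemma prior_of_length (d : Fin m → K) {t : History} (ht : t.length = k) :
    P.prior νX νY cA cB d t =
      jointMean νX νY cA cB d fun p r => if P.transcript p r = t then 1 else 0 := by
  rw [prior, ht]
  rfl

section

variable (hX : ∀ e, νX e ∈ stdSimplex ℝ X) (hY : ∀ e, νY e ∈ stdSimplex ℝ Y)
  (hA : cA ∈ stdSimplex ℝ A) (hB : cB ∈ stdSimplex ℝ B) (d : Fin m → K)

include hX hY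

lemma sum_coordMass (i : Fin m) (e : K) {t : History} (ht : t.length = k) :
    ∑ x, ∑ y, νX e x * νY e y * P.coordMass νX νY cA cB d i x y t =
      P.prior νX νY cA cB (Function.update d i e) t := by
  rw [prior_of_length P _ ht, ← jointMean_setInput hX hY d i e]
  rfl

lemma coordMass_update (i : Fin m) (e : K) (x : X) (y : Y) (t : History) :
    P.coordMass νX νY cA cB (Function.update d i e) i x y t =
      P.coordMass νX νY cA cB d i x y t :=
  jointMean_setInput_update hX hY d i e x y fun p r => if P.transcript p r = t then 1 else 0

include hA hB

lemma coinWeight_mul_nonneg (p : (Fin m → X) × A) (r : (Fin m → Y) × B) :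
    0 ≤ coinWeight νX cA d p * coinWeight νY cB d r :=
  mul_nonneg (coinWeight_nonneg (fun e => (hX e).1) hA.1 d p)
    (coinWeight_nonneg (fun e => (hY e).1) hB.1 d r)

lemma jointMean_mono {G G' : (Fin m → X) × A → (Fin m → Y) × B → ℝ}
    (h : ∀ p r, 0 < coinWeight νX cA d p * coinWeight νY cB d r → G p r ≤ G' p r) :
    jointMean νX νY cA cB d G ≤ jointMean νX νY cA cB d G' := by
  refine Finset.sum_le_sum fun p _ => Finset.sum_le_sum fun r _ => ?_
  rcases (coinWeight_mul_nonneg hX hY hA hB d p r).eq_or_lt with h0 | h0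
  · simp [← h0]
  · exact mul_le_mul_of_nonneg_left (h p r h0) h0.le

lemma coinWeight_le_jointMean (E : (Fin m → X) × A → (Fin m → Y) × B → Prop)
    [∀ p r, Decidable (E p r)] {p : (Fin m → X) × A} {r : (Fin m → Y) × B} (h : E p r) :
    coinWeight νX cA d p * coinWeight νY cB d r ≤
      jointMean νX νY cA cB d fun p r => if E p r then 1 else 0 := by
  have hw := coinWeight_mul_nonneg hX hY hA hB d
  have h1 := Finset.single_le_sum (s := Finset.univ)
    (f := fun z : ((Fin m → X) × A) × ((Fin m → Y) × B) =>
      coinWeight νX cA d z.1 * coinWeight νY cB d z.2 * if E z.1 z.2 then 1 else 0)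
    (fun z _ => mul_nonneg (hw _ _) (by split_ifs <;> norm_num)) (Finset.mem_univ (p, r))
  rw [Fintype.sum_prod_type] at h1
  simpa [h, jointMean] using h1

lemma prior_nonneg (h : History) : 0 ≤ P.prior νX νY cA cB d h :=
  Finset.sum_nonneg fun p _ => Finset.sum_nonneg fun r _ =>
    mul_nonneg (coinWeight_mul_nonneg hX hY hA hB d p r) (by dsimp only; split_ifs <;> norm_num)

lemma coordMass_nonneg (i : Fin m) (x : X) (y : Y) (t : History) :
    0 ≤ P.coordMass νX νY cA cB d i x y t :=
  Finset.sum_nonneg fun p _ => Finset.sum_nonneg fun r _ =>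
    mul_nonneg (coinWeight_mul_nonneg hX hY hA hB d p r) (by dsimp only; split_ifs <;> norm_num)

lemma prior_nil : P.prior νX νY cA cB d [] = 1 := by
  rw [← jointMean_one hX hY hA hB d]
  simp [prior, history]

/-- For fixed inputs and coins a history has at most one continuation by one message, so the
indicators of the continuations sum to at most that of the history. -/
lemma isSemimeasure_prior : IsSemimeasure (P.prior νX νY cA cB d) where
  nonneg := P.prior_nonneg hX hY hA hB d
  sum_le h S := by
    simp only [prior, jointMean]
    rw [Finset.sum_comm]
    refine Finset.sum_le_sum fun p _ => ?_
    rw [Finset.sum_comm]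
    refine Finset.sum_le_sum fun r _ => ?_
    rw [← Finset.mul_sum]
    refine mul_le_mul_of_nonneg_left ?_ (coinWeight_mul_nonneg hX hY hA hB d p r)
    simp only [List.length_append, List.length_cons, List.length_nil, zero_add, history]
    by_cases h1 : P.history p r h.length = h
    · simp only [h1, if_true, List.append_cancel_left_eq, List.cons.injEq, and_true]
      rw [Finset.sum_ite_eq]
      split_ifs <;> norm_num
    · rw [if_neg h1]
      refine (Finset.sum_eq_zero fun m' _ => if_neg fun h2 => h1 ?_).le
      exact (List.append_inj h2 (by rw [length_history])).1

/-- The transcript of a protocol of cost `c` has mutual information at most `c` bits with all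
coordinates of the input together, provided that the coordinates are independent. -/
theorem sum_coordInfo_le :
    ∑ i, P.coordInfo νX νY cA cB i d ≤ P.cost * Real.log 2 := by
  let S : Finset History := Finset.univ.image
    fun z : ((Fin m → X) × A) × ((Fin m → Y) × B) => P.transcript z.1 z.2
  -- The sum of the log-ratios is the logarithm of `∏ i, φ t i` at the actual transcript, which is
  -- at most the sum of these products over all `t ∈ S`. For fixed `t` the product has mean at most
  -- `1`, by independence and because the numerators average to the prior. With at most `2 ^ P.cost`
  -- transcripts, `log u ≤ u - 1` at scale `2 ^ P.cost` finishes the bound.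
  let φ : History → Fin m → X → Y → ℝ := fun t i x y =>
    P.coordMass νX νY cA cB d i x y t / P.prior νX νY cA cB d t
  have hφ : ∀ t i x y, 0 ≤ φ t i x y := fun t i x y =>
    div_nonneg (P.coordMass_nonneg hX hY hA hB d i x y t) (P.prior_nonneg hX hY hA hB d t)
  have h2c : (0 : ℝ) < 2 ^ P.cost := by positivity
  have hlog : ∀ p r, 0 < coinWeight νX cA d p * coinWeight νY cB d r →
      ∑ i, (Real.log (P.coordMass νX νY cA cB d i (p.1 i) (r.1 i) (P.transcript p r)) -
        Real.log (P.prior νX νY cA cB d (P.transcript p r))) ≤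
      P.cost * Real.log 2 +
        ((∑ t ∈ S, ∏ i, φ t i (p.1 i) (r.1 i)) / 2 ^ P.cost - 1) := by
    intro p r hpr
    have hprior : 0 < P.prior νX νY cA cB d (P.transcript p r) := by
      rw [P.prior_of_length d (P.length_transcript p r)]
      exact hpr.trans_le (coinWeight_le_jointMean hX hY hA hB d
        (fun p' r' => P.transcript p' r' = P.transcript p r) rfl)
    have hcoord : ∀ i,
        0 < P.coordMass νX νY cA cB d i (p.1 i) (r.1 i) (P.transcript p r) := fun i =>
      hpr.trans_le (coinWeight_le_jointMean hX hY hA hB d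
        (fun p' r' => P.transcript (setInput i (p.1 i) p') (setInput i (r.1 i) r') =
          P.transcript p r) (by rw [setInput_self, setInput_self]))
    have h1 : ∑ i, (Real.log (P.coordMass νX νY cA cB d i (p.1 i) (r.1 i) (P.transcript p r)) -
        Real.log (P.prior νX νY cA cB d (P.transcript p r))) =
        Real.log (∏ i, φ (P.transcript p r) i (p.1 i) (r.1 i)) := by
      rw [Real.log_prod fun i _ => (div_pos (hcoord i) hprior).ne']
      exact Finset.sum_congr rfl fun i _ => (Real.log_div (hcoord i).ne' hprior.ne').symm
    have h2 : 0 < ∏ i, φ (P.transcript p r) i (p.1 i) (r.1 i) :=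
      Finset.prod_pos fun i _ => div_pos (hcoord i) hprior
    have h3 : ∏ i, φ (P.transcript p r) i (p.1 i) (r.1 i) ≤
        ∑ t ∈ S, ∏ i, φ t i (p.1 i) (r.1 i) :=
      Finset.single_le_sum (f := fun t => ∏ i, φ t i (p.1 i) (r.1 i))
        (fun t _ => Finset.prod_nonneg fun i _ => hφ _ _ _ _)
        (Finset.mem_image_of_mem _ (Finset.mem_univ (p, r)))
    have h4 := Real.log_le_sub_one_of_pos (div_pos h2 h2c)
    rw [Real.log_div h2.ne' h2c.ne', Real.log_pow] at h4
    have h5 := div_le_div_of_nonneg_right h3 h2c.le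
    rw [h1]
    linarith
  have hsum : jointMean νX νY cA cB d
      (fun p r => ∑ t ∈ S, ∏ i, φ t i (p.1 i) (r.1 i)) ≤ 2 ^ P.cost := by
    have h1 : jointMean νX νY cA cB d (fun p r => ∑ t ∈ S, ∏ i, φ t i (p.1 i) (r.1 i)) =
        ∑ t ∈ S, jointMean νX νY cA cB d (fun p r => ∏ i, φ t i (p.1 i) (r.1 i)) := by
      simp only [jointMean, Finset.mul_sum]
      rw [Finset.sum_comm]
      simp only [Finset.sum_comm (s := S)]
      rw [Finset.sum_comm]
    have h2 : ∀ t ∈ S, jointMean νX νY cA cB d (fun p r => ∏ i, φ t i (p.1 i) (r.1 i)) ≤ 1 := by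
      intro t ht
      obtain ⟨z, _, rfl⟩ := Finset.mem_image.1 ht
      rw [jointMean_prod hA hB d]
      refine Finset.prod_le_one (fun i _ => Finset.sum_nonneg fun x _ => Finset.sum_nonneg
        fun y _ => mul_nonneg (mul_nonneg ((hX _).1 x) ((hY _).1 y)) (hφ _ _ _ _))
        fun i _ => ?_
      have h3 := P.sum_coordMass hX hY (cA := cA) (cB := cB) d i (d i)
        (P.length_transcript z.1 z.2)
      rw [Function.update_eq_self] at h3
      simp only [φ, ← mul_div_assoc, ← Finset.sum_div]
      rw [h3]
      exact div_self_le_one _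
    rw [h1]
    refine (Finset.sum_le_sum h2).trans ?_
    rw [Finset.sum_const, nsmul_eq_mul, mul_one]
    exact_mod_cast P.card_transcripts_le
  have hadd : ∑ i, P.coordInfo νX νY cA cB i d = jointMean νX νY cA cB d fun p r =>
      ∑ i, (Real.log (P.coordMass νX νY cA cB d i (p.1 i) (r.1 i) (P.transcript p r)) -
        Real.log (P.prior νX νY cA cB d (P.transcript p r))) := by
    simp only [coordInfo, jointMean, Finset.mul_sum]
    rw [Finset.sum_comm]
    refine Finset.sum_congr rfl fun p _ => ?_
    rw [Finset.sum_comm]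
  rw [hadd]
  refine (jointMean_mono hX hY hA hB d hlog).trans ?_
  have hlin : ∀ Ψ : (Fin m → X) × A → (Fin m → Y) × B → ℝ,
      jointMean νX νY cA cB d (fun p r => P.cost * Real.log 2 + (Ψ p r / 2 ^ P.cost - 1)) =
      (P.cost * Real.log 2 - 1) * jointMean νX νY cA cB d (fun _ _ => 1) +
      jointMean νX νY cA cB d Ψ / 2 ^ P.cost := by
    intro Ψ
    simp only [jointMean, Finset.mul_sum, Finset.sum_div, ← Finset.sum_add_distrib]
    exact Finset.sum_congr rfl fun p _ => Finset.sum_congr rfl fun r _ => by ring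
  rw [hlin, jointMean_one hX hY hA hB d]
  have := (div_le_one h2c).2 hsum
  linarith

end

end DetProtocol

end

noncomputable section

/-! ### The mixed prior and the entropy of the partition -/

namespace DetProtocol

variable {first out : Player} {k m : ℕ} {X Y Z K A B : Type*} [Fintype X] [Fintype Y]
  [Fintype A] [Fintype B] [Fintype K]
  (P : DetProtocol first out k ((Fin m → X) × A) ((Fin m → Y) × B) (Fin m → Z))
  {νX : K → X → ℝ} {νY : K → Y → ℝ} {cA : A → ℝ} {cB : B → ℝ} {κ : K → ℝ}
  (hX : ∀ e, νX e ∈ stdSimplex ℝ X) (hY : ∀ e, νY e ∈ stdSimplex ℝ Y)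
  (hA : cA ∈ stdSimplex ℝ A) (hB : cB ∈ stdSimplex ℝ B) (hκ : κ ∈ stdSimplex ℝ K)

/-- The distribution of the history, when the `i`-th inputs are drawn according to a random index
with distribution `κ`, and the other ones according to `d`. -/
def mixedPrior (νX : K → X → ℝ) (νY : K → Y → ℝ) (cA : A → ℝ) (cB : B → ℝ) (κ : K → ℝ)
    (i : Fin m) (d : Fin m → K) (h : History) : ℝ :=
  ∑ e, κ e * P.prior νX νY cA cB (Function.update d i e) h

include hX hY hA hB hκ

/-- Average over independent indices from `κ` and over the coordinates. Resampling the `i`-th index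
does not change the mean, so the other indices can be fixed while this one stays random; thus `H(κ)`
is paid for one coordinate only. -/
lemma exists_coordInfo_le (hm : 0 < m) : ∃ (i : Fin m) (d : Fin m → K),
    ∑ e, κ e * P.coordInfo νX νY cA cB i (Function.update d i e) ≤
      P.cost / m * Real.log 2 := by
  have hw : ∀ d : Fin m → K, 0 ≤ ∏ j, κ (d j) := fun d => Finset.prod_nonneg fun j _ => hκ.1 _
  have hw1 : ∑ d : Fin m → K, ∏ j, κ (d j) = 1 := sum_prod_pi_eq_one fun _ => hκ.2
  have h1 : ∑ i, ∑ d : Fin m → K, (∏ j, κ (d j)) * P.coordInfo νX νY cA cB i d ≤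
      P.cost * Real.log 2 := by
    rw [Finset.sum_comm]
    simp only [← Finset.mul_sum]
    calc _ ≤ ∑ d : Fin m → K, (∏ j, κ (d j)) * (P.cost * Real.log 2) :=
          Finset.sum_le_sum fun d _ =>
            mul_le_mul_of_nonneg_left (P.sum_coordInfo_le hX hY hA hB d) (hw d)
      _ = _ := by rw [← Finset.sum_mul, hw1, one_mul]
  have hm' : (0 : ℝ) < m := by exact_mod_cast hm
  obtain ⟨i, _, hi⟩ := Finset.exists_le_of_sum_le (s := (Finset.univ : Finset (Fin m)))
    (f := fun i => ∑ d : Fin m → K, (∏ j, κ (d j)) * P.coordInfo νX νY cA cB i d)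
    (g := fun _ => P.cost / m * Real.log 2) ⟨⟨0, hm⟩, Finset.mem_univ _⟩ (by
      refine h1.trans (le_of_eq ?_)
      rw [Finset.sum_const, Finset.card_univ, Fintype.card_fin, nsmul_eq_mul]
      field_simp)
  rw [← sum_prod_pi_update (fun _ => κ) i hκ.2] at hi
  obtain ⟨d, _, hd⟩ := exists_pos_weight_le hw hw1 fun d =>
    ∑ e, κ e * P.coordInfo νX νY cA cB i (Function.update d i e)
  exact ⟨i, d, hd.trans hi⟩

lemma isSemimeasure_mixedPrior (i : Fin m) (d : Fin m → K) :
    IsSemimeasure (P.mixedPrior νX νY cA cB κ i d) where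
  nonneg h := Finset.sum_nonneg fun e _ =>
    mul_nonneg (hκ.1 e) (P.prior_nonneg hX hY hA hB _ h)
  sum_le h S := by
    unfold mixedPrior
    rw [Finset.sum_comm]
    refine Finset.sum_le_sum fun e _ => ?_
    rw [← Finset.mul_sum]
    exact mul_le_mul_of_nonneg_left ((P.isSemimeasure_prior hX hY hA hB _).sum_le h S) (hκ.1 e)

lemma mixedPrior_nil (i : Fin m) (d : Fin m → K) :
    P.mixedPrior νX νY cA cB κ i d [] = 1 := by
  simp only [mixedPrior, P.prior_nil hX hY hA hB, mul_one]
  exact hκ.2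

lemma le_mixedPrior (i : Fin m) (d : Fin m → K) (e : K) (h : History) :
    κ e * P.prior νX νY cA cB (Function.update d i e) h ≤
      P.mixedPrior νX νY cA cB κ i d h :=
  Finset.single_le_sum (f := fun e => κ e * P.prior νX νY cA cB (Function.update d i e) h)
    (fun e _ => mul_nonneg (hκ.1 e) (P.prior_nonneg hX hY hA hB _ h)) (Finset.mem_univ e)

/-- Absolute continuity, as the compression requires: an input pair of positive weight has positive
weight under some component `e` with `κ e > 0`, whose prior then charges the transcript. -/
lemma mixedPrior_pos (i : Fin m) (d : Fin m → K) {x : X} {y : Y}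
    (hxy : 0 < ∑ e, κ e * (νX e x * νY e y)) {p : (Fin m → X) × A} {r : (Fin m → Y) × B}
    (hp : 0 < coinWeight νX cA d p) (hr : 0 < coinWeight νY cB d r) :
    0 < P.mixedPrior νX νY cA cB κ i d ((P.embed i).transcript (x, p) (y, r)) := by
  obtain ⟨e, _, he⟩ := Finset.exists_lt_of_sum_lt (s := Finset.univ) (f := fun _ => (0 : ℝ))
    (g := fun e => κ e * (νX e x * νY e y)) (by simpa using hxy)
  have hν : 0 ≤ νX e x * νY e y := mul_nonneg ((hX e).1 x) ((hY e).1 y)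
  have hκe : 0 < κ e := pos_of_mul_pos_left he hν
  have hνe : 0 < νX e x * νY e y := pos_of_mul_pos_right he hκe.le
  refine lt_of_lt_of_le (mul_pos hκe ?_) (P.le_mixedPrior hX hY hA hB hκ i d e _)
  rw [embed_transcript, ← P.sum_coordMass hX hY d i e (P.length_transcript _ _)]
  set t := P.transcript (setInput i x p) (setInput i y r)
  have h1 : 0 < P.coordMass νX νY cA cB d i x y t :=
    (mul_pos hp hr).trans_le (coinWeight_le_jointMean hX hY hA hB d
      (fun p' r' => P.transcript (setInput i x p') (setInput i y r') = t) rfl)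
  have h0 : ∀ x y, 0 ≤ νX e x * νY e y * P.coordMass νX νY cA cB d i x y t := fun x y =>
    mul_nonneg (mul_nonneg ((hX e).1 x) ((hY e).1 y)) (P.coordMass_nonneg hX hY hA hB d i x y t)
  calc 0 < νX e x * νY e y * P.coordMass νX νY cA cB d i x y t := mul_pos hνe h1
    _ ≤ ∑ y, νX e x * νY e y * P.coordMass νX νY cA cB d i x y t :=
      Finset.single_le_sum (f := fun y => νX e x * νY e y * P.coordMass νX νY cA cB d i x y t)
        (fun y _ => h0 x y) (Finset.mem_univ y)
    _ ≤ _ := Finset.single_le_sum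
        (f := fun x => ∑ y, νX e x * νY e y * P.coordMass νX νY cA cB d i x y t)
        (fun x _ => Finset.sum_nonneg fun y _ => h0 x y) (Finset.mem_univ x)

/-- The divergence of the transcript of the embedded protocol from the mixed prior. -/
lemma sum_infoMass_le (i : Fin m) (d : Fin m → K) :
    ∑ x, ∑ y, (∑ e, κ e * (νX e x * νY e y)) *
      (P.embed i).infoMass (fun _ => coinWeight νX cA d) (fun _ => coinWeight νY cB d)
        (P.mixedPrior νX νY cA cB κ i d) x y ≤
    ∑ e, κ e * P.coordInfo νX νY cA cB i (Function.update d i e) +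
      shannonEntropy κ * Real.log 2 := by
  let q := P.mixedPrior νX νY cA cB κ i d
  let G : (Fin m → X) × A → (Fin m → Y) × B → ℝ := fun p r =>
    Real.log (P.coordMass νX νY cA cB d i (p.1 i) (r.1 i) (P.transcript p r)) -
      Real.log (q (P.transcript p r))
  have h1 : ∀ x y, (P.embed i).infoMass (fun _ => coinWeight νX cA d)
      (fun _ => coinWeight νY cB d) q x y =
      jointMean νX νY cA cB d fun p r => G (setInput i x p) (setInput i y r) := by
    intro x y
    have hq : q [] = 1 := P.mixedPrior_nil hX hY hA hB hκ i d
    simp only [infoMass, jointMean, G, embed_transMass, embed_transcript, setInput_apply, hq,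
      sum_coinWeight (fun e => (hX e).2) hA.2, sum_coinWeight (fun e => (hY e).2) hB.2, mul_one,
      Real.log_one, sub_zero, add_zero]
  have h2 : ∑ x, ∑ y, (∑ e, κ e * (νX e x * νY e y)) *
      (P.embed i).infoMass (fun _ => coinWeight νX cA d) (fun _ => coinWeight νY cB d) q x y =
      ∑ e, κ e * jointMean νX νY cA cB (Function.update d i e) G := by
    simp only [h1, Finset.sum_mul]
    simp only [← jointMean_setInput hX hY d i _ G, Finset.mul_sum]
    rw [Finset.sum_comm' (t' := Finset.univ) (s' := fun _ => Finset.univ) (by simp),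
      Finset.sum_comm]
    refine (Finset.sum_congr rfl fun x _ => Finset.sum_comm).trans ?_
    rw [Finset.sum_comm]
    refine Finset.sum_congr rfl fun e _ => Finset.sum_congr rfl fun x _ =>
      Finset.sum_congr rfl fun y _ => by ring
  rw [h2]
  have h3 : shannonEntropy κ * Real.log 2 = ∑ e, κ e * -Real.log (κ e) := by
    have hl2 : Real.log 2 ≠ 0 := (Real.log_pos (by norm_num)).ne'
    rw [shannonEntropy, neg_mul, Finset.sum_mul, ← Finset.sum_neg_distrib]
    refine Finset.sum_congr rfl fun e _ => ?_
    rw [Real.logb]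
    field_simp
  rw [h3, ← Finset.sum_add_distrib]
  refine Finset.sum_le_sum fun e _ => ?_
  rw [← mul_add]
  rcases (hκ.1 e).eq_or_lt with h0 | h0
  · simp [← h0]
  refine mul_le_mul_of_nonneg_left ?_ h0.le
  have h4 : P.coordInfo νX νY cA cB i (Function.update d i e) + -Real.log (κ e) =
      jointMean νX νY cA cB (Function.update d i e) fun p r =>
        (Real.log (P.coordMass νX νY cA cB d i (p.1 i) (r.1 i) (P.transcript p r)) -
        Real.log (P.prior νX νY cA cB (Function.update d i e) (P.transcript p r))) -
        Real.log (κ e) := by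
    rw [← mul_one (-Real.log (κ e)), ← jointMean_one hX hY hA hB (Function.update d i e)]
    simp only [coordInfo, coordMass_update P hX hY]
    simp only [jointMean, Finset.mul_sum, ← Finset.sum_add_distrib]
    exact Finset.sum_congr rfl fun p _ => Finset.sum_congr rfl fun r _ => by ring
  rw [h4]
  refine jointMean_mono hX hY hA hB _ fun p r hpr => ?_
  have h5 : 0 < P.prior νX νY cA cB (Function.update d i e) (P.transcript p r) := by
    rw [P.prior_of_length _ (P.length_transcript p r)]
    exact hpr.trans_le (coinWeight_le_jointMean hX hY hA hB _
      (fun p' r' => P.transcript p' r' = P.transcript p r) rfl)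
  -- The mixture is at least `κ e` times its component, so passing to it costs at most `-log (κ e)`,
  -- and the mean of this over `κ` is the entropy.
  have h6 := Real.log_le_log (mul_pos h0 h5) (P.le_mixedPrior hX hY hA hB hκ i d e _)
  rw [Real.log_mul h0.ne' h5.ne'] at h6
  simp only [G, q]
  linarith

-- The error bound of `P` holds for every input, hence for each choice of the other instances, and a
-- wrong `i`-th answer makes the whole answer wrong.
omit hκ [Fintype K] in
open scoped Classical in
lemma embed_errMass_le {f : X → Y → Z} {δ : ℝ}
    (herr : ∀ x y, 1 - δ ≤ ∑ a, ∑ b,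
      if P.answer (x, a) (y, b) = copies f m x y then cA a * cB b else 0)
    (i : Fin m) (d : Fin m → K) (x : X) (y : Y) :
    (P.embed i).errMass f (fun _ => coinWeight νX cA d) (fun _ => coinWeight νY cB d) x y ≤ δ := by
  have h1 : ∀ (u : Fin m → X) (v : Fin m → Y), ∑ a, ∑ b,
      (if (P.embed i).answer (x, (u, a)) (y, (v, b)) ≠ f x y then cA a * cB b else 0) ≤ δ := by
    intro u v
    have h2 := herr (Function.update u i x) (Function.update v i y)
    have h3 : ∑ a, ∑ b, cA a * cB b = 1 := by
      rw [← Finset.sum_mul_sum, hA.2, hB.2, one_mul]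
    have h4 : ∑ a, ∑ b,
        (if (P.embed i).answer (x, (u, a)) (y, (v, b)) ≠ f x y then cA a * cB b else 0) ≤
        ∑ a, ∑ b, (cA a * cB b - if P.answer (Function.update u i x, a) (Function.update v i y, b) =
          copies f m (Function.update u i x) (Function.update v i y) then cA a * cB b else 0) := by
      refine Finset.sum_le_sum fun a _ => Finset.sum_le_sum fun b _ => ?_
      have h0 : 0 ≤ cA a * cB b := mul_nonneg (hA.1 a) (hB.1 b)
      rw [embed_answer, setInput, setInput]
      by_cases hc : P.answer (Function.update u i x, a) (Function.update v i y, b) =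
          copies f m (Function.update u i x) (Function.update v i y)
      · simp [hc, copies]
      · rw [if_neg hc, sub_zero]
        split_ifs
        exacts [le_rfl, h0]
    simp only [Finset.sum_sub_distrib, h3] at h4
    linarith
  have h2 : (P.embed i).errMass f (fun _ => coinWeight νX cA d)
      (fun _ => coinWeight νY cB d) x y =
      ∑ u : Fin m → X, ∑ v : Fin m → Y, (∏ j, νX (d j) (u j)) * (∏ j, νY (d j) (v j)) *
        ∑ a, ∑ b,
          if (P.embed i).answer (x, (u, a)) (y, (v, b)) ≠ f x y then cA a * cB b else 0 := by
    simp only [errMass, Fintype.sum_prod_type, coinWeight, Finset.mul_sum]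
    refine Finset.sum_congr rfl fun u _ => ?_
    rw [Finset.sum_comm]
    refine Finset.sum_congr rfl fun v _ => Finset.sum_congr rfl fun a _ =>
      Finset.sum_congr rfl fun b _ => ?_
    split_ifs <;> ring
  rw [h2]
  calc _ ≤ ∑ u : Fin m → X, ∑ v : Fin m → Y,
        (∏ j, νX (d j) (u j)) * (∏ j, νY (d j) (v j)) * δ :=
        Finset.sum_le_sum fun u _ => Finset.sum_le_sum fun v _ =>
          mul_le_mul_of_nonneg_left (h1 u v) (mul_nonneg
            (Finset.prod_nonneg fun j _ => (hX _).1 _) (Finset.prod_nonneg fun j _ => (hY _).1 _))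
    _ = δ := by
        have e1 : ∑ u : Fin m → X, ∏ j, νX (d j) (u j) = 1 :=
          sum_prod_pi_eq_one fun j => (hX (d j)).2
        have e2 : ∑ v : Fin m → Y, ∏ j, νY (d j) (v j) = 1 :=
          sum_prod_pi_eq_one fun j => (hY (d j)).2
        simp only [← Finset.sum_mul, ← Finset.mul_sum, e1, e2, one_mul]

open scoped Classical in
/-- A protocol for `m` instances of `f` yields a deterministic protocol for one of them, with the
error and the communication controlled together. -/
theorem exists_single_instance [Nonempty Z] (hm : 0 < m) {f : X → Y → Z} {δ lam η : ℝ}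
    (hlam : 0 ≤ lam) (hη : 0 < η)
    (herr : ∀ x y, 1 - δ ≤ ∑ a, ∑ b,
      if P.answer (x, a) (y, b) = copies f m x y then cA a * cB b else 0) :
    ∃ Q : DetProtocol first out k X Y Z,
      ∑ x, ∑ y, (∑ e, κ e * (νX e x * νY e y)) *
        ((if Q.answer x y ≠ f x y then 1 else 0) + lam * Q.bits x y) ≤
      δ + lam * (4 * (P.cost / m + shannonEntropy κ) + 14 * k) + k * η := by
  obtain ⟨i, d, hid⟩ := P.exists_coordInfo_le hX hY hA hB hκ hm
  let g : X → Y → ℝ := fun x y => ∑ e, κ e * (νX e x * νY e y)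
  have hg : ∀ x y, 0 ≤ g x y := fun x y => Finset.sum_nonneg fun e _ =>
    mul_nonneg (hκ.1 e) (mul_nonneg ((hX e).1 x) ((hY e).1 y))
  have hg1 : ∑ x, ∑ y, g x y = 1 := by
    have : ∑ e, κ e * ∑ x, ∑ y, νX e x * νY e y = 1 := by
      simp only [← Finset.sum_mul_sum, (hX _).2, (hY _).2, mul_one]
      exact hκ.2
    rw [← this]
    simp only [g, Finset.mul_sum]
    rw [Finset.sum_comm]
    refine (Finset.sum_congr rfl fun x _ => Finset.sum_comm).trans ?_
    rw [Finset.sum_comm]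
    refine (Finset.sum_congr rfl fun x _ => Finset.sum_comm).trans ?_
    rw [Finset.sum_comm]
  obtain ⟨Q, hQ⟩ := compressible (first := first) (out := out) (k := k) (f := f) hlam hη
    (P.embed i) (fun _ => coinWeight νX cA d) (fun _ => coinWeight νY cB d)
    (P.mixedPrior νX νY cA cB κ i d) g
    (fun _ => coinWeight_nonneg (fun e => (hX e).1) hA.1 d)
    (fun _ => coinWeight_nonneg (fun e => (hY e).1) hB.1 d) hg
    (P.isSemimeasure_mixedPrior hX hY hA hB hκ i d)
    (fun x y hxy p r hp hr => P.mixedPrior_pos hX hY hA hB hκ i d hxy hp hr)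
  refine ⟨Q, ?_⟩
  have e1 := sum_coinWeight (ν := νX) (fun e => (hX e).2) hA.2 d
  have e2 := sum_coinWeight (ν := νY) (fun e => (hY e).2) hB.2 d
  simp only [e1, e2, mul_one, simBound] at hQ
  refine hQ.trans ?_
  have hl2 : 0 < Real.log 2 := Real.log_pos (by norm_num)
  have h1 := P.sum_infoMass_le hX hY hA hB hκ i d
  have h2 : ∑ x, ∑ y, g x y * (P.embed i).infoMass (fun _ => coinWeight νX cA d)
      (fun _ => coinWeight νY cB d) (P.mixedPrior νX νY cA cB κ i d) x y ≤
      (P.cost / m + shannonEntropy κ) * Real.log 2 := by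
    refine h1.trans ?_
    rw [add_mul]
    linarith
  calc _ ≤ ∑ x, ∑ y, (δ * g x y + lam * (4 / Real.log 2) *
        (g x y * (P.embed i).infoMass (fun _ => coinWeight νX cA d)
          (fun _ => coinWeight νY cB d) (P.mixedPrior νX νY cA cB κ i d) x y) +
        (lam * (14 * k) + k * η) * g x y) := by
        refine Finset.sum_le_sum fun x _ => Finset.sum_le_sum fun y _ => ?_
        have := mul_le_mul_of_nonneg_left
          (P.embed_errMass_le hX hY hA hB herr i d x y) (hg x y)
        linarith
    _ = δ + lam * (4 / Real.log 2) *
        ∑ x, ∑ y, (g x y * (P.embed i).infoMass (fun _ => coinWeight νX cA d)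
          (fun _ => coinWeight νY cB d) (P.mixedPrior νX νY cA cB κ i d) x y) +
        (lam * (14 * k) + k * η) := by
        simp only [Finset.sum_add_distrib, ← Finset.mul_sum, hg1, mul_one]
    _ ≤ δ + lam * (4 / Real.log 2) * ((P.cost / m + shannonEntropy κ) * Real.log 2) +
        (lam * (14 * k) + k * η) := by
        gcongr
    _ = _ := by
        field_simp
        ring

end DetProtocol

end

/-! ### From mean communication to the distributional complexity -/

noncomputable section

open DetProtocol

lemma shannonEntropy_nonneg {K : Type*} [Fintype K] {κ : K → ℝ} (hκ : κ ∈ stdSimplex ℝ K) :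
    0 ≤ shannonEntropy κ := by
  rw [shannonEntropy, ← Finset.sum_neg_distrib]
  refine Finset.sum_nonneg fun e _ => ?_
  have h1 : κ e ≤ 1 := hκ.2 ▸ Finset.single_le_sum (fun e _ => hκ.1 e) (Finset.mem_univ e)
  have := mul_nonpos_of_nonneg_of_nonpos (hκ.1 e)
    (Real.logb_nonpos one_lt_two (hκ.1 e) h1)
  linarith

lemma nonempty_of_mem_stdSimplex {K : Type*} [Fintype K] {κ : K → ℝ}
    (hκ : κ ∈ stdSimplex ℝ K) : Nonempty K := by
  by_contra h
  rw [not_nonempty_iff] at h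
  simpa using hκ.2

section

variable {first out : Player} {k m : ℕ} {X Y Z K : Type*} [Fintype X] [Fintype Y] [Fintype K]

open scoped Classical in
/-- Markov's inequality: cutting off the communication turns a bound on the error plus the expected
communication into a bound on the distributional complexity. -/
lemma distComplexity_le_of_mean_le (Q : DetProtocol first out k X Y Z) {f : X → Y → Z}
    {μ : X × Y → ℝ} (hμ : μ ∈ stdSimplex ℝ (X × Y)) {b δ : ℝ} (hb : 0 < b)
    (h : ∑ x, ∑ y, μ (x, y) *
      ((if Q.answer x y ≠ f x y then 1 else 0) + 1 / b * Q.bits x y) ≤ δ) :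
    distComplexity first out k μ δ f ≤ (⌊b⌋₊ : ℕ∞) := by
  have hQ : (Q.truncate ⌊b⌋₊).HasDistError f μ δ := by
    unfold HasDistError
    have h1 : ∑ p : X × Y, (μ p -
        if (Q.truncate ⌊b⌋₊).answer p.1 p.2 = f p.1 p.2 then μ p else 0) ≤ δ := by
      refine le_trans ?_ h
      rw [Fintype.sum_prod_type]
      refine Finset.sum_le_sum fun x _ => Finset.sum_le_sum fun y _ => ?_
      have h0 : 0 ≤ μ (x, y) := hμ.1 _
      have hn : 0 ≤ 1 / b * (Q.bits x y : ℝ) := by positivity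
      dsimp only
      rcases le_or_gt (Q.bits x y) ⌊b⌋₊ with hle | hlt
      · rw [Q.truncate_answer hle]
        by_cases hc : Q.answer x y = f x y
        · rw [if_pos hc, sub_self, if_neg (not_not.2 hc)]
          positivity
        · rw [if_neg hc, if_pos hc, sub_zero]
          exact le_mul_of_one_le_right h0 (by linarith)
      -- On a run that is cut off, `bits / b` alone exceeds `1` and pays for a possible error.
      · have h2 : b < Q.bits x y := (Nat.floor_lt hb.le).1 hlt
        have h3 : 1 ≤ 1 / b * (Q.bits x y : ℝ) := by
          rw [one_div_mul_eq_div, le_div_iff₀ hb]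
          linarith
        have h4 : (0 : ℝ) ≤ if Q.answer x y ≠ f x y then 1 else 0 := by
          split_ifs <;> norm_num
        have h5 : (0 : ℝ) ≤ if (Q.truncate ⌊b⌋₊).answer x y = f x y then μ (x, y) else 0 := by
          split_ifs
          exacts [h0, le_rfl]
        have h6 := le_mul_of_one_le_right h0
          (show 1 ≤ (if Q.answer x y ≠ f x y then 1 else 0) + 1 / b * (Q.bits x y : ℝ) by linarith)
        linarith
    rw [Finset.sum_sub_distrib, hμ.2] at h1
    linarith
  refine (iInf₂_le (Q.truncate ⌊b⌋₊) hQ).trans ?_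
  exact_mod_cast Finset.sup_le fun (p : X × Y) _ => Q.truncate_bits_le ⌊b⌋₊ p.1 p.2

/-- The direct sum inequality for one private coin protocol. -/
theorem distComplexity_le_of_protocol (P : PrivateCoinProtocol first out k (Fin m → X) (Fin m → Y)
    (Fin m → Z)) {f : X → Y → Z} {ε δ : ℝ} (hm : 0 < m) (hk : 0 < k) (hε : 0 < ε) (hδ : 0 < δ)
    (hP : P.HasError (copies f m) δ) {μ : X × Y → ℝ} (hμ : μ ∈ stdSimplex ℝ (X × Y))
    {κ : K → ℝ} (hκμ : Partitions κ μ) :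
    distComplexity first out k μ (δ + 2 * ε) f ≤
      (⌊2 * k / ε ^ 2 * (P.cost / m + 2 + shannonEntropy κ)⌋₊ : ℕ∞) := by
  classical
  obtain ⟨hκ, ν, hν, hμν⟩ := hκμ
  choose νX hX νY hY hνXY using hν
  obtain ⟨⟨x₀, y₀⟩⟩ := nonempty_of_mem_stdSimplex hμ
  have : Nonempty Z := ⟨f x₀ y₀⟩
  have hH := shannonEntropy_nonneg hκ
  have hk' : (1 : ℝ) ≤ k := by exact_mod_cast hk
  have hc : (0 : ℝ) ≤ P.cost / m := by positivity
  set b : ℝ := 2 * k / ε ^ 2 * (P.cost / m + 2 + shannonEntropy κ) with hb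
  have hb0 : 0 < b := by positivity
  -- For `ε > 1 / 2` the allowed error exceeds `1`, and silence suffices.
  rcases lt_or_ge (1 / 2) ε with hlt | hle
  · refine distComplexity_le_of_mean_le (silent first out k (fun _ => f x₀ y₀) fun _ => f x₀ y₀)
      hμ hb0 ?_
    simp only [silent_bits, Nat.cast_zero, mul_zero, add_zero]
    calc _ ≤ ∑ x, ∑ y, μ (x, y) := by
          refine Finset.sum_le_sum fun x _ => Finset.sum_le_sum fun y _ => ?_
          exact mul_le_of_le_one_right (hμ.1 _) (by split_ifs <;> norm_num)
      _ = 1 := by rw [← Fintype.sum_prod_type]; exact hμ.2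
      _ ≤ _ := by linarith
  · have herr : ∀ x y, 1 - δ ≤ ∑ a, ∑ b, if P.det.answer (x, a) (y, b) = copies f m x y then
        P.coinA a * P.coinB b else 0 := by
      intro x y
      convert hP x y
    -- Of the slack `2 ε`, the failures of the `k` rounds take `k η = ε / 4`, and the communication
    -- takes the remaining `7 ε / 4`.
    obtain ⟨Q, hQ⟩ := P.det.exists_single_instance hX hY P.coinA_mem P.coinB_mem hκ hm
      (lam := 1 / b) (η := ε / (4 * k)) (by positivity) (by positivity) herr
    refine distComplexity_le_of_mean_le Q hμ hb0 ?_
    simp only [hμν, hνXY]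
    refine hQ.trans ?_
    change δ + 1 / b * (4 * ((P.cost : ℝ) / m + shannonEntropy κ) + 14 * k) +
      k * (ε / (4 * k)) ≤ _
    set a : ℝ := P.cost / m + shannonEntropy κ with ha
    have ha0 : 0 ≤ a := by positivity
    have h1 : 1 / b * (4 * a + 14 * k) ≤ 7 / 4 * ε := by
      rw [one_div_mul_eq_div, div_le_iff₀ hb0, hb,
        show (P.cost : ℝ) / m + 2 + shannonEntropy κ = a + 2 by rw [ha]; ring]
      have h2 : 7 / 4 * ε * (2 * k / ε ^ 2 * (a + 2)) = 7 / 2 * (k * (a + 2)) / ε := by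
        field_simp
        ring
      rw [h2, le_div_iff₀ hε]
      have h3 : 0 ≤ 4 * a + 14 * k := by positivity
      -- Uses `k ≥ 1`. Dividing by `b = 2 k (a + 2) / ε ^ 2` gives `7 ε ^ 2 / 2`, which is at most
      -- `7 ε / 4` because `ε ≤ 1 / 2`.
      have h4 : 4 * a + 14 * k ≤ 7 * (k * (a + 2)) := by nlinarith
      nlinarith
    have h2 : (k : ℝ) * (ε / (4 * k)) = ε / 4 := by field_simp
    linarith

end

/-! ### Transfer to extended real complexities -/

section

lemma complexityToEReal_coe (n : ℕ) : complexityToEReal (n : ℕ∞) = ((n : ℝ) : EReal) := by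
  simp only [complexityToEReal]
  norm_cast

/-- The floor bound makes `D` finite, so the claim is a real inequality solved for `n`. As `D` is
arbitrary, it applies to one distribution and to a supremum alike. -/
lemma le_complexityToEReal_of_le_floor {m k n : ℕ} (hm : 0 < m) (hk : 0 < k) {ε H : ℝ}
    (hε : 0 < ε) (hH : 0 ≤ H) {D R : ℕ∞} (hR : (n : ℕ∞) ≤ R)
    (hD : D ≤ (⌊2 * k / ε ^ 2 * ((n : ℝ) / m + 2 + H)⌋₊ : ℕ∞)) :
    (m : EReal) * (((ε ^ 2 / (2 * k) : ℝ) : EReal) * complexityToEReal D - 2 - (H : EReal)) ≤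
      complexityToEReal R := by
  have hmono : complexityToEReal (n : ℕ∞) ≤ complexityToEReal R := by
    unfold complexityToEReal
    exact_mod_cast hR
  refine le_trans ?_ hmono
  obtain ⟨j, rfl⟩ := ENat.ne_top_iff_exists.1 (ne_top_of_le_ne_top (ENat.natCast_ne_top _) hD)
  have hj : (j : ℝ) ≤ 2 * k / ε ^ 2 * ((n : ℝ) / m + 2 + H) :=
    (Nat.le_floor_iff (by positivity)).1 (by exact_mod_cast hD)
  have hm' : (0 : ℝ) < m := by exact_mod_cast hm
  have hk' : (0 : ℝ) < k := by exact_mod_cast hk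
  rw [complexityToEReal_coe, complexityToEReal_coe]
  have key : (m : ℝ) * (ε ^ 2 / (2 * k) * j - 2 - H) ≤ n := by
    have h1 : ε ^ 2 / (2 * k) * j ≤ (n : ℝ) / m + 2 + H := by
      refine (mul_le_mul_of_nonneg_left hj (by positivity)).trans (le_of_eq ?_)
      field_simp
    have h2 : ε ^ 2 / (2 * k) * j - 2 - H ≤ (n : ℝ) / m := by linarith
    calc _ ≤ (m : ℝ) * ((n : ℝ) / m) := mul_le_mul_of_nonneg_left h2 hm'.le
      _ = n := by field_simp
  rw [← EReal.coe_coe_eq_natCast m, show (2 : EReal) = ((2 : ℝ) : EReal) from rfl,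
    ← EReal.coe_mul, ← EReal.coe_sub, ← EReal.coe_sub, ← EReal.coe_mul]
  exact EReal.coe_le_coe_iff.2 key

lemma exists_protocol_of_randComplexity_ne_top {first out : Player} {k : ℕ} {X Y Z : Type*}
    [Fintype X] [Fintype Y] {f : X → Y → Z} {δ : ℝ}
    (h : randComplexity first out k δ f ≠ ⊤) :
    ∃ P : PrivateCoinProtocol first out k X Y Z, P.HasError f δ ∧
      (P.cost : ℕ∞) ≤ randComplexity first out k δ f := by
  obtain ⟨n, hn⟩ := ENat.ne_top_iff_exists.1 h
  have hlt : randComplexity first out k δ f < ((n + 1 : ℕ) : ℕ∞) := by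
    rw [← hn]
    exact_mod_cast Nat.lt_succ_self n
  simp only [randComplexity, iInf_lt_iff] at hlt
  obtain ⟨P, hP, hPn⟩ := hlt
  refine ⟨P, hP, ?_⟩
  rw [← hn]
  have : P.cost < n + 1 := by exact_mod_cast hPn
  exact_mod_cast Nat.lt_succ_iff.1 this

lemma IsProductDist.mem_stdSimplex {X Y : Type*} [Fintype X] [Fintype Y] {μ : X × Y → ℝ}
    (h : IsProductDist μ) : μ ∈ stdSimplex ℝ (X × Y) := by
  obtain ⟨μX, hX, μY, hY, hμ⟩ := h
  refine ⟨fun p => ?_, ?_⟩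
  · rw [show p = (p.1, p.2) from rfl, hμ]
    exact mul_nonneg (hX.1 _) (hY.1 _)
  · rw [Fintype.sum_prod_type]
    simp only [hμ]
    rw [← Finset.sum_mul_sum, hX.2, hY.2, one_mul]

lemma IsProductDist.partitions {X Y : Type*} [Fintype X] [Fintype Y] {μ : X × Y → ℝ}
    (h : IsProductDist μ) : Partitions (fun _ : Unit => (1 : ℝ)) μ :=
  ⟨⟨fun _ => zero_le_one, by simp⟩, fun _ => μ, fun _ => h, fun p => by simp⟩

end

end

theorem mainTheorem2 {X Y Z : Type*} [Fintype X] [Fintype Y] (f : X → Y → Z)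
    (first out : Player) (m k : ℕ) (hm : 0 < m) (hk : 0 < k)
    (ε δ : ℝ) (hε : 0 < ε) (hδ : 0 < δ) :
    (∀ (μ : X × Y → ℝ) (_ : μ ∈ stdSimplex ℝ (X × Y)) (K : Type*) (_ : Fintype K) (κ : K → ℝ)
        (_ : Partitions κ μ),
      (m : EReal) *
          (((ε ^ 2 / (2 * k) : ℝ) : EReal) *
              complexityToEReal (distComplexity first out k μ (δ + 2 * ε) f)
            - 2 - ((shannonEntropy κ : ℝ) : EReal))
        ≤ complexityToEReal (randComplexity first out k δ (copies f m))) ∧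
    (m : EReal) *
        (((ε ^ 2 / (2 * k) : ℝ) : EReal) *
            complexityToEReal (productComplexity first out k (δ + 2 * ε) f) - 2)
      ≤ complexityToEReal (randComplexity first out k δ (copies f m)) := by
  by_cases htop : randComplexity first out k δ (copies f m) = ⊤
  · have h : complexityToEReal (randComplexity first out k δ (copies f m)) = ⊤ := by
      rw [htop]
      simp [complexityToEReal]
    rw [h]
    exact ⟨fun _ _ _ _ _ _ => le_top, le_top⟩
  · obtain ⟨P, hP, hcost⟩ := exists_protocol_of_randComplexity_ne_top htop
    refine ⟨fun μ hμ K _ κ hκ => ?_, ?_⟩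
    · exact le_complexityToEReal_of_le_floor hm hk hε (shannonEntropy_nonneg hκ.1) hcost
        (distComplexity_le_of_protocol P hm hk hε hδ hP hμ hκ)
    -- One protocol `P` bounds all product distributions at once: each is partitioned by the
    -- one-point distribution, of entropy `0`.
    · have h := le_complexityToEReal_of_le_floor (D := productComplexity first out k (δ + 2 * ε) f)
        hm hk hε le_rfl hcost (iSup₂_le fun μ hμ => by
          have h1 := distComplexity_le_of_protocol P hm hk hε hδ hP hμ.mem_stdSimplex hμ.partitions
          have h2 : shannonEntropy (fun _ : Unit => (1 : ℝ)) = 0 := by simp [shannonEntropy]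
          rwa [h2] at h1)
      simpa using h
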